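/- Fix an integer $d\ge 2$ and $\beta\in\mathbb C$ with $\beta^d=1$, $\beta\ne 1$. For sequences $x=(x_i)_{i\ge1}\in\mathbb C^{\mathbb N^*}$ put $x_0:=0$. A sequence is preperiodic of type $(k,m)\in\mathbb N\times\mathbb N^*$ if $x_{i+m}=x_i$ for all $i\ge k+1$, and of exact type $(k,m)$ if moreover $k$ and $m$ are the smallest such integers ($k$ is its preperiod, $m$ its period). For $(k,m)\in\mathbb N\times\mathbb N^*$ let $H_{k,m}=\{x:\beta x_{k+m}-x_k=0\}$, let $M_{k,m}$ be the (finite-dimensional) space of all $x\in H_{k,m}$ that are of type $(k,m)$, let $Q(x)=(0,x_1^d,x_2^d,\dots)$, and let $F_{k,m}=\pi_{k,m}\circ Q$, where $\pi_{k,m}$ is the projection of $\mathbb C^{\mathbb N^*}$ onto $H_{k,m}$ parallel to the line of constant sequences; $F_{k,m}$ maps $M_{k,m}$ to itself. Let $G_{k,m}:\mathbb C^{k+m-1}\to\mathbb C^{k+m-1}$ be the map whose $j$-th component ($1\le j\le k+m-1$) at $x=(x_1,\dots,x_{k+m-1})$ is, with $x_0:=0$, $$x_{j-1}^d-x_{m-1}^d\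 \text{ if }k=0,\qquad \Bigl(x_{j-1}-\tfrac{\beta x_{k+m-1}-x_{k-1}}{\beta-1}\Bigr)^d\ \text{ if }k\ge1 .$$ Let $(k',m')\preceq(k,m)$ mean that $m'\mid m$ and either $k'=k$, or $k'=0$ and $m'\mid k$. **Theorem.** (A) The relation $\preceq$ is a partial order on $\mathbb N\times\mathbb N^*$, and for all $(k,m),(k',m')\in\mathbb N\times\mathbb N^*$ one has $(k',m')\preceq(k,m)$ if and only if $M_{k',m'}\subseteq M_{k,m}$, $M_{k',m'}$ is $F_{k,m}$-invariant, and the restriction of $F_{k,m}$ to $M_{k',m'}$ is $F_{k',m'}$. (B) For every $(k,m)\in\mathbb N\times\mathbb N^*$ the map $F_{k,m}:M_{k,m}\to M_{k,m}$ is holomorphic, and it is conjugate to $G_{k,m}$ by a biholomorphic map $M_{k,m}\to\mathbb C^{k+m-1}$. (C) Let $(k,m)\in\mathbb N\times\mathbb N^*$, let $z\in M_{k,m}\setminus\{0\}$ be a fixed point of $F_{k,m}$, let $(k',m')$ be the exact type of the sequence $z$, let $P(t)=t^d+z_1$, and let $\lambda=(P^{\circ m'})'(P^{\circ k'}(z_1))$.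 Then: 1. $P$ is post-critically finite, $z=(P^{\circ j}(0))_{j\ge1}$, and the critical value $z_1$ of $P$ is preperiodic under $P$ of preperiod $k'$ to a cycle of period $m'$ (whose multiplier is $\lambda$). 2. $(k',m')\preceq(k,m)$. 3. $z\in M_{k',m'}$, and the spectrum of the derivative $D_zF_{k',m'}:M_{k',m'}\to M_{k',m'}$ is contained in $\mathbb C\setminus\overline{\mathbb D}$. 4. If $(k,m)\ne(k',m')$, then the annihilator $M_{k',m'}^0=\{\omega\in M_{k,m}^*:\omega|_{M_{k',m'}}=0\}$ is invariant under the transpose $(D_zF_{k,m})^*$, and the spectrum of the restriction of $(D_zF_{k,m})^*$ to $M_{k',m'}^0$ is $\{0\}$ if $k'=0$, and $\{\mu\in\mathbb C:\mu^m=\lambda^{m/m'},\ \mu^{m'}\ne\lambda\}$ if $k'\ne0$. -/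

import Mathlib

open Polynomial

noncomputable section

/-- The space `ℂ^{ℕ*}` of complex sequences `(x_i)_{i ≥ 1}`, with the product topology. -/
abbrev KochSeq : Type := ℕ+ → ℂ

/-- The `i`-th term of a sequence, with the convention `x_0 = 0`. -/
def kochTerm (x : KochSeq) (i : ℕ) : ℂ := if h : 0 < i then x (i.toPNat h) else 0

lemma kochTerm_zero (x : KochSeq) : kochTerm x 0 = 0 := by simp [kochTerm]

lemma kochTerm_of_pos (x : KochSeq) {i : ℕ} (h : 0 < i) : kochTerm x i = x (i.toPNat h) := by
  simp [kochTerm, h]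

lemma kochTerm_add (x y : KochSeq) (i : ℕ) :
    kochTerm (x + y) i = kochTerm x i + kochTerm y i := by
  unfold kochTerm; split_ifs <;> simp

lemma kochTerm_smul (c : ℂ) (x : KochSeq) (i : ℕ) :
    kochTerm (c • x) i = c * kochTerm x i := by
  unfold kochTerm; split_ifs <;> simp

/-- `x` is preperiodic of type `(k, m)`: `x_{i+m} = x_i` for all `i ≥ k + 1`. -/
def KochHasType (x : KochSeq) (k m : ℕ) : Prop :=
  ∀ i : ℕ, k + 1 ≤ i → kochTerm x (i + m) = kochTerm x i

/-- `x` is preperiodic of exact type `(k, m)`: `k` and `m ≥ 1` are the smallest integers such that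
`x` is of type `(k, m)`. Then `k` is the preperiod of `x` and `m` is its period. -/
def KochHasExactType (x : KochSeq) (k m : ℕ) : Prop :=
  0 < m ∧ KochHasType x k m ∧ ∀ a b : ℕ, 0 < b → KochHasType x a b → k ≤ a ∧ m ≤ b

/-- Every preperiodic sequence has an exact type. -/
lemma KochHasType.exists_exactType {x : KochSeq} {a b : ℕ} (hb : 0 < b) (h : KochHasType x a b) :
    ∃ k m : ℕ, KochHasExactType x k m := by
  classical
  have hk : ∃ k, ∃ m, 0 < m ∧ KochHasType x k m := ⟨a, b, hb, h⟩
  have hm : ∃ m, 0 < m ∧ KochHasType x (Nat.find hk) m := Nat.find_spec hk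
  refine ⟨Nat.find hk, Nat.find hm, (Nat.find_spec hm).1, (Nat.find_spec hm).2, ?_⟩
  intro a' b' hb' h'
  refine ⟨Nat.find_min' hk ⟨b', hb', h'⟩, Nat.find_min' hm ⟨hb', ?_⟩⟩
  obtain ⟨n, hn, hT⟩ := hm
  intro i hi
  have step : ∀ N j : ℕ, Nat.find hk + 1 ≤ j → kochTerm x (j + N * n) = kochTerm x j := by
    intro N
    induction N with
    | zero => intro j _; simp
    | succ N ih =>
      intro j hj
      rw [show j + (N + 1) * n = (j + N * n) + n by ring, hT _ (by omega), ih j hj]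
  have hle : a' + 1 ≤ i + (a' + 1) * n := by nlinarith
  rw [← step (a' + 1) (i + b') (by omega), ← step (a' + 1) i hi,
    show i + b' + (a' + 1) * n = (i + (a' + 1) * n) + b' by ring]
  exact h' _ hle

/-- The space `P_{k,m}` of preperiodic sequences of type `(k, m)`. -/
def kochP (k : ℕ) (m : ℕ+) : Submodule ℂ KochSeq where
  carrier := {x | KochHasType x k m}
  zero_mem' := by intro i _; simp [kochTerm]
  add_mem' := by
    intro x y hx hy i hi
    rw [kochTerm_add, kochTerm_add, hx i hi, hy i hi]
  smul_mem' := by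
    intro c x hx i hi
    rw [kochTerm_smul, kochTerm_smul, hx i hi]

/-- The hyperplane `H_{k,m} = {x | β x_{k+m} - x_k = 0}`. -/
def kochH (β : ℂ) (k : ℕ) (m : ℕ+) : Submodule ℂ KochSeq where
  carrier := {x | β * kochTerm x (k + m) - kochTerm x k = 0}
  zero_mem' := by
    change β * kochTerm 0 (k + m) - kochTerm 0 k = 0
    simp [kochTerm]
  add_mem' := by
    intro x y hx hy
    change β * kochTerm (x + y) (k + m) - kochTerm (x + y) k = 0
    change β * kochTerm x (k + m) - kochTerm x k = 0 at hx
    change β * kochTerm y (k + m) - kochTerm y k = 0 at hy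
    rw [kochTerm_add, kochTerm_add]
    linear_combination hx + hy
  smul_mem' := by
    intro c x hx
    change β * kochTerm (c • x) (k + m) - kochTerm (c • x) k = 0
    change β * kochTerm x (k + m) - kochTerm x k = 0 at hx
    rw [kochTerm_smul, kochTerm_smul]
    linear_combination c * hx

/-- The line `L` of constant sequences. -/
def kochL : Submodule ℂ KochSeq where
  carrier := {x | ∀ i j, x i = x j}
  zero_mem' := by intro i j; rfl
  add_mem' := by
    intro x y hx hy i j
    simp [hx i j, hy i j]
  smul_mem' := by
    intro c x hx i j
    simp [hx i j]

/-- The space `M_{k,m} = P_{k,m} ∩ H_{k,m}`. -/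
def kochM (β : ℂ) (k : ℕ) (m : ℕ+) : Submodule ℂ KochSeq := kochP k m ⊓ kochH β k m

/-- The constant by which the projection onto `H_{k,m}` parallel to `L` translates a sequence. -/
def kochShift (β : ℂ) (k : ℕ) (m : ℕ+) (x : KochSeq) : ℂ :=
  if k = 0 then kochTerm x m else (β * kochTerm x (k + m) - kochTerm x k) / (β - 1)

/-- The projection of the space of sequences onto `H_{k,m}` parallel to `L`
(see `kochProj_mem`, `sub_kochProj_mem` and `kochH_isCompl`). -/
def kochProj (β : ℂ) (k : ℕ) (m : ℕ+) (x : KochSeq) : KochSeq :=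
  fun i => x i - kochShift β k m x

lemma kochTerm_proj (β : ℂ) (k : ℕ) (m : ℕ+) (x : KochSeq) {i : ℕ} (hi : 0 < i) :
    kochTerm (kochProj β k m x) i = kochTerm x i - kochShift β k m x := by
  simp [kochTerm, hi, kochProj]

lemma kochProj_mem {β : ℂ} (hβ1 : β ≠ 1) (k : ℕ) (m : ℕ+) (x : KochSeq) :
    kochProj β k m x ∈ kochH β k m := by
  change β * kochTerm _ (k + m) - kochTerm _ k = 0
  have h1 : β - 1 ≠ 0 := sub_ne_zero.mpr hβ1
  have hm := m.pos
  rw [kochTerm_proj _ _ _ _ (by omega)]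
  rcases Nat.eq_zero_or_pos k with rfl | hk
  · simp [kochTerm_zero, kochShift]
  · rw [kochTerm_proj _ _ _ _ hk]
    simp only [kochShift, if_neg hk.ne']
    field_simp
    ring

lemma sub_kochProj_mem (β : ℂ) (k : ℕ) (m : ℕ+) (x : KochSeq) :
    x - kochProj β k m x ∈ kochL := by
  intro i j
  simp [kochProj]

lemma kochH_isCompl {β : ℂ} (hβ0 : β ≠ 0) (hβ1 : β ≠ 1) (k : ℕ) (m : ℕ+) :
    IsCompl (kochH β k m) kochL := by
  have h1 : β - 1 ≠ 0 := sub_ne_zero.mpr hβ1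
  constructor
  · rw [Submodule.disjoint_def]
    intro x hx hL
    have hx' : β * kochTerm x (k + m) - kochTerm x k = 0 := hx
    have hm : 0 < k + (m : ℕ) := by have := m.pos; omega
    have key : kochTerm x (k + m) = 0 := by
      rcases Nat.eq_zero_or_pos k with rfl | hk
      · simpa [kochTerm_zero, hβ0] using hx'
      · have : kochTerm x k = kochTerm x (k + m) := by
          rw [kochTerm_of_pos x hk, kochTerm_of_pos x hm]; exact hL _ _
        rw [this] at hx'
        have : (β - 1) * kochTerm x (k + m) = 0 := by linear_combination hx'
        exact (mul_eq_zero.mp this).resolve_left h1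
    funext i
    rw [kochTerm_of_pos x hm] at key
    exact (hL i _).trans key
  · rw [codisjoint_iff, eq_top_iff]
    intro x _
    have := Submodule.add_mem_sup (kochProj_mem hβ1 k m x) (sub_kochProj_mem β k m x)
    simpa using this

/-- The map `Q`: `Q(x)_1 = 0` and `Q(x)_i = x_{i-1}^d` for `i ≥ 2`. -/
def kochQ (d : ℕ) (x : KochSeq) : KochSeq :=
  fun i => if i = 1 then 0 else kochTerm x ((i : ℕ) - 1) ^ d

/-- The map `F_{k,m} = π_{k,m} ∘ Q` on the space of all sequences. -/
def kochMap (d : ℕ) (β : ℂ) (k : ℕ) (m : ℕ+) (x : KochSeq) : KochSeq :=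
  kochProj β k m (kochQ d x)

lemma kochTerm_kochQ {d : ℕ} (hd : 2 ≤ d) (x : KochSeq) (i : ℕ) :
    kochTerm (kochQ d x) (i + 1) = kochTerm x i ^ d := by
  rw [kochTerm_of_pos _ (Nat.succ_pos i)]
  rcases Nat.eq_zero_or_pos i with rfl | hi
  · have : (0 + 1).toPNat (Nat.succ_pos 0) = 1 := rfl
    simp [kochQ, kochTerm_zero, this, show d ≠ 0 by omega]
  · have : (i + 1).toPNat (Nat.succ_pos i) ≠ 1 := by
      intro h
      have := congrArg PNat.val h
      change i + 1 = 1 at this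
      omega
    rw [kochQ, if_neg this]
    rfl

lemma kochMap_mem {d : ℕ} (hd : 2 ≤ d) {β : ℂ} (hβ : β ^ d = 1) (hβ1 : β ≠ 1) (k : ℕ) (m : ℕ+)
    {x : KochSeq} (hx : x ∈ kochM β k m) : kochMap d β k m x ∈ kochM β k m := by
  refine ⟨?_, kochProj_mem hβ1 k m _⟩
  have hP : KochHasType x k m := hx.1
  have hH : β * kochTerm x (k + m) - kochTerm x k = 0 := hx.2
  intro i hi
  obtain ⟨j, rfl⟩ : ∃ j, i = j + 1 := ⟨i - 1, by omega⟩
  rw [kochMap, kochTerm_proj _ _ _ _ (by omega), kochTerm_proj _ _ _ _ (by omega),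
    show j + 1 + (m : ℕ) = (j + m) + 1 by ring, kochTerm_kochQ hd, kochTerm_kochQ hd]
  congr 1
  rcases Nat.lt_or_ge k j with h | h
  · rw [hP j h]
  · obtain rfl : j = k := by omega
    rw [← sub_eq_zero.mp hH, mul_pow, hβ, one_mul]

/-- The map `F_{k,m}` restricted to `M_{k,m}`. -/
def kochF {d : ℕ} (hd : 2 ≤ d) {β : ℂ} (hβ : β ^ d = 1) (hβ1 : β ≠ 1) (k : ℕ) (m : ℕ+) :
    kochM β k m → kochM β k m :=
  fun x => ⟨kochMap d β k m x, kochMap_mem hd hβ hβ1 k m x.2⟩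

/-- The derivative `D_z F_{k,m}`, as an endomorphism of `M_{k,m}` (the tangent space of the vector
space `M_{k,m}` at `z` is identified with `M_{k,m}`). -/
def kochD {d : ℕ} (hd : 2 ≤ d) {β : ℂ} (hβ : β ^ d = 1) (hβ1 : β ≠ 1) (k : ℕ) (m : ℕ+)
    (z : kochM β k m) : Module.End ℂ (kochM β k m) :=
  (fderiv ℂ (kochF hd hβ hβ1 k m) z).toLinearMap

/-- The annihilator of `M_{k',m'}` in the dual of `M_{k,m}`: the linear forms on `M_{k,m}` that
vanish on `M_{k',m'}` (used when `M_{k',m'} ⊆ M_{k,m}`). -/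
def kochAnn (β : ℂ) (k : ℕ) (m : ℕ+) (k' : ℕ) (m' : ℕ+) :
    Submodule ℂ (Module.Dual ℂ (kochM β k m)) :=
  ((kochM β k' m').submoduleOf (kochM β k m)).dualAnnihilator

/-- The coordinate `x_i` (`1 ≤ i ≤ n`) of a point of `ℂ^n`, with the convention `x_0 = 0`. -/
def kochCoord {n : ℕ} (x : Fin n → ℂ) (i : ℕ) : ℂ :=
  if h : 0 < i ∧ i ≤ n then x ⟨i - 1, by omega⟩ else 0

/-- The map `G_{k,m}` on `ℂ^{k+m-1}`. The entry of index `j : Fin (k + m - 1)` is the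
`(j + 1)`-st component. -/
def kochG (d : ℕ) (β : ℂ) (k : ℕ) (m : ℕ+) (x : Fin (k + m - 1) → ℂ) : Fin (k + m - 1) → ℂ :=
  fun j =>
    if k = 0 then kochCoord x j ^ d - kochCoord x (m - 1) ^ d
    else (kochCoord x j - (β * kochCoord x (k + m - 1) - kochCoord x (k - 1)) / (β - 1)) ^ d

/-- `f` and `g` are conjugate by a biholomorphic map. -/
def HolomorphicallyConjugate {V W : Type*} [AddCommGroup V] [Module ℂ V] [TopologicalSpace V]
    [AddCommGroup W] [Module ℂ W] [TopologicalSpace W] (f : V → V) (g : W → W) : Prop :=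
  ∃ φ : V ≃ W, Differentiable ℂ φ ∧ Differentiable ℂ φ.symm ∧ ∀ x, φ (f x) = g (φ x)

/-- The relation `(k', m') ⪯ (k, m)` on `ℕ × ℕ*`. -/
def KochLE (p q : ℕ × ℕ+) : Prop :=
  (p.2 : ℕ) ∣ q.2 ∧ (p.1 = q.1 ∨ (p.1 = 0 ∧ (p.2 : ℕ) ∣ q.1))

/-- A complex polynomial is post-critically finite if the union of the forward orbits
`P^{∘j}(c)`, `j ≥ 1`, of its critical points `c` in `ℂ` is finite. (The point at infinity is
fixed by `P`.) -/
def PostCriticallyFinite (P : ℂ[X]) : Prop :=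
  (⋃ j ≥ 1, (fun t => P.eval t)^[j] '' {c : ℂ | P.derivative.eval c = 0}).Finite

/-- The point `w` is preperiodic under `f` of preperiod `k` to a cycle of period `m`: `k` and
`m ≥ 1` are the smallest integers with `f^{∘(k+m)}(w) = f^{∘k}(w)`. -/
def IsPreperiodicPoint {α : Type*} (f : α → α) (w : α) (k m : ℕ) : Prop :=
  0 < m ∧ f^[k + m] w = f^[k] w ∧
    ∀ a b : ℕ, 0 < b → f^[a + b] w = f^[a] w → k ≤ a ∧ m ≤ b

/-- The multiplier `(P^{∘m})'(w)` of the cycle of a point `w` of period `m` of `P`. -/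
def cycleMultiplier (P : ℂ[X]) (w : ℂ) (m : ℕ) : ℂ :=
  deriv ((fun t => P.eval t)^[m]) w

end

/-!
Writing `P(t) = t ^ d + z_1`, a fixed point `z` of `F_{k,m}` is the orbit of the critical value of
`P`, and `(D_zF v)_i = P'(z_{i-1}) v_{i-1} - s(v)`, where the constant `s(v)` comes from the
projection `π` along the constant sequences. All spectral statements are read off from left
eigenvectors of this operator.

*Along `M_{k',m'}`* (`spectrum_kochD_subset`). Let `ω ∘ D_zF = λ ω` on `M_{k',m'}` and set
`q(w) = ω(π(U(w)))`, where `U(w)_i = 1 / (w - z_i)`: a rational quadratic differential with simple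
poles on the postcritical set. The push-forward of `dt² / (t - a)` under `P` is
`(1 / (w - P(a)) - 1 / (w - P(0))) / P'(a)` (`sum_pushforward_inv_sub`), which says that the
push-forward is dual to the inverse of `D_zF`, that is `q = λ P_* q`. The push-forward does not
increase area, and the preimage of a large disk under `P` lies in a smaller concentric disk. Hence
`|λ| ≤ 1` forces `q` to vanish on an annulus (`infinite_zeros_of_pushforward_eq`). As the points
`z_1, …, z_{k'+m'}` are distinct, all residues of `q` vanish and `ω = 0`. The decay of `q` at
infinity plays no role, since only disks are compared.

*Transverse to `M_{k',m'}`*. The difference `Δv_i = v_{i+m'} - v_i` kills the constant `s(v)`, and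
`D_zF` acts on it as the shift weighted by `P'(z_i)` (`kochTerm_kochD_pow_sub`). If `k' = 0`, a
weight in each period vanishes, so `D_zF` is nilpotent modulo `M_{k',m'}`. If `k' ≠ 0`, then
`k = k'`, and with `p = m / m'` the sum of `λ^{p-1-j} (D_zF)^{m' j}` over `j < p` telescopes to zero
modulo `M_{k,m'}`, where now `λ` is the multiplier of the cycle (`sum_kochD_pow_mem`). For a left
eigenvalue `μ`, the number `μ^{m'}` is thus a root of `(y^p - λ^p) / (y - λ)`, that is, a `p`-th root
of `λ^p` other than `λ`; conversely each such `μ` has an explicit left eigenvector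
(`exists_left_eigenvector_of_pow_eq`).

That an inclusion `M_{k',m'} ⊆ M_{k,m}` implies `(k',m') ⪯ (k,m)` is tested on indicator sequences
of residue classes (`kochLE_of_kochM_le`). For `k ≥ 1` the conjugacy with `G_{k,m}` exchanges `π ∘ Q`
and `Q ∘ π` (`kochF_conjugate_kochG`).
-/

noncomputable section

/-! ### Preperiodic sequences and their exact types -/

/-- The sequence `(f 1, f 2, …)`; the value `f 0` is forgotten. -/
def kochOf (f : ℕ → ℂ) : KochSeq := fun i => f i

lemma kochTerm_of (f : ℕ → ℂ) {i : ℕ} (hi : 0 < i) : kochTerm (kochOf f) i = f i := by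
  rw [kochTerm_of_pos _ hi]; rfl

lemma kochTerm_coe (x : KochSeq) (i : ℕ+) : kochTerm x i = x i := by
  rw [kochTerm_of_pos _ i.pos]; rfl

lemma kochSeq_ext {x y : KochSeq} (h : ∀ i, 0 < i → kochTerm x i = kochTerm y i) : x = y := by
  funext i
  rw [← kochTerm_coe x, ← kochTerm_coe y, h i i.pos]

lemma mem_kochM_iff {β : ℂ} {k : ℕ} {m : ℕ+} {x : KochSeq} :
    x ∈ kochM β k m ↔ KochHasType x k m ∧ β * kochTerm x (k + m) = kochTerm x k := by
  rw [← sub_eq_zero (a := β * kochTerm x (k + m))]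
  exact Iff.rfl

lemma KochHasType.mul {x : KochSeq} {k m : ℕ} (h : KochHasType x k m) (n : ℕ) :
    KochHasType x k (m * n) := by
  induction n with
  | zero => intro i _; simp
  | succ n ih =>
    intro i hi
    rw [mul_add, mul_one, ← add_assoc, h _ (by omega), ih i hi]

lemma KochHasType.of_dvd {x : KochSeq} {k m m' : ℕ} (h : KochHasType x k m') (hm : m' ∣ m) :
    KochHasType x k m := by
  obtain ⟨n, rfl⟩ := hm
  exact h.mul n

lemma KochHasType.mono {x : KochSeq} {k k' m : ℕ} (h : KochHasType x k' m) (hk : k' ≤ k) :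
    KochHasType x k m := fun i hi => h i (by omega)

/-- A type need only be checked far out once the sequence is known to have some type with the same
preperiod. -/
lemma KochHasType.of_eventually {x : KochSeq} {k m b N : ℕ} (hm : 0 < m) (h : KochHasType x k m)
    (hb : ∀ i, N ≤ i → kochTerm x (i + b) = kochTerm x i) : KochHasType x k b := by
  intro i hi
  rw [← h.mul N i hi, ← h.mul N (i + b) (by omega), ← hb (i + m * N) (by nlinarith)]
  congr 1
  ring

lemma KochHasExactType.le_and_dvd {x : KochSeq} {k m a b : ℕ} (h : KochHasExactType x k m)
    (hb : 0 < b) (hx : KochHasType x a b) : k ≤ a ∧ m ∣ b := by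
  refine ⟨(h.2.2 a b hb hx).1, ?_⟩
  by_contra hmb
  have hr : 0 < b % m := Nat.pos_of_ne_zero fun h0 => hmb (Nat.dvd_of_mod_eq_zero h0)
  have hk := (h.2.2 a b hb hx).1
  have hT : KochHasType x a (b % m) := by
    intro i hi
    rw [← h.2.1.mul (b / m) (i + b % m) (by omega), add_assoc, Nat.mod_add_div, hx i hi]
  have := (h.2.2 a _ hr hT).2
  exact absurd (Nat.mod_lt b h.1) (by omega)

lemma beta_ne_zero {d : ℕ} (hd : 2 ≤ d) {β : ℂ} (hβ : β ^ d = 1) : β ≠ 0 := by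
  rintro rfl
  rw [zero_pow (by omega)] at hβ
  exact zero_ne_one hβ

/-! ### The partial order -/

lemma kochLE_isPartialOrder : IsPartialOrder (ℕ × ℕ+) KochLE where
  refl p := ⟨dvd_rfl, Or.inl rfl⟩
  trans p q r hpq hqr := by
    obtain ⟨h1, h2⟩ := hpq
    obtain ⟨h3, h4⟩ := hqr
    refine ⟨h1.trans h3, ?_⟩
    rcases h2 with h2 | ⟨h2, h2'⟩
    · rcases h4 with h4 | ⟨h4, h4'⟩
      · exact Or.inl (h2.trans h4)
      · exact Or.inr ⟨h2.trans h4, h1.trans h4'⟩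
    · rcases h4 with h4 | ⟨h4, h4'⟩
      · exact Or.inr ⟨h2, h4 ▸ h2'⟩
      · exact Or.inr ⟨h2, h1.trans h4'⟩
  antisymm p q hpq hqp := by
    have h2 : p.2 = q.2 := PNat.coe_injective (Nat.dvd_antisymm hpq.1 hqp.1)
    refine Prod.ext ?_ h2
    rcases hpq.2 with h | ⟨h, -⟩
    · exact h
    · rcases hqp.2 with h' | ⟨h', -⟩
      · exact h'.symm
      · rw [h, h']

lemma kochTerm_eq_zero_of_dvd {β : ℂ} (hβ0 : β ≠ 0) {m : ℕ+} {x : KochSeq}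
    (hx : x ∈ kochM β 0 m) {i : ℕ} (hi : (m : ℕ) ∣ i) : kochTerm x i = 0 := by
  obtain ⟨n, rfl⟩ := hi
  obtain ⟨hT, hH⟩ := mem_kochM_iff.1 hx
  have hm : kochTerm x m = 0 := by
    simpa [kochTerm_zero, hβ0] using hH
  rcases n with _ | n
  · simp [kochTerm_zero]
  · rw [mul_add, mul_one, add_comm, hT.mul n _ m.pos, hm]

lemma kochM_le_of_kochLE {β : ℂ} (hβ0 : β ≠ 0) {k k' : ℕ} {m m' : ℕ+}
    (h : KochLE (k', m') (k, m)) : kochM β k' m' ≤ kochM β k m := by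
  intro x hx
  obtain ⟨hm, hk⟩ := h
  simp only at hm hk
  obtain ⟨hT, hH⟩ := mem_kochM_iff.1 hx
  refine mem_kochM_iff.2 ⟨(hT.of_dvd hm).mono (by omega), ?_⟩
  rcases hk with rfl | ⟨rfl, hk⟩
  · obtain ⟨n, hn⟩ := hm
    obtain ⟨n, rfl⟩ : ∃ n', n = n' + 1 :=
      ⟨n - 1, by have := m.pos; rcases n with _ | n <;> simp_all⟩
    rw [hn, mul_add, mul_one, add_comm (_ * n), ← add_assoc,
      hT.mul n _ (by have := m'.pos; omega), hH]
  · rw [kochTerm_eq_zero_of_dvd hβ0 hx hk, kochTerm_eq_zero_of_dvd hβ0 hx (dvd_add hk hm), mul_zero]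

/-- If `M_{k',m'} ⊆ M_{k,m}` then `(k',m') ⪯ (k,m)`. The inclusion is tested on the sequence that is
`1` on the part of a residue class modulo `m'` beyond `k'`, vanishes elsewhere beyond `k'`, and is
completed at the index `k'` as the equation of the hyperplane `H_{k',m'}` requires. -/
lemma kochLE_of_kochM_le {β : ℂ} (hβ0 : β ≠ 0) (hβ1 : β ≠ 1) {k k' : ℕ} {m m' : ℕ+}
    (h : kochM β k' m' ≤ kochM β k m) : KochLE (k', m') (k, m) := by
  have hm' := m'.pos
  have hm := m.pos
  rcases Nat.eq_zero_or_pos k' with rfl | hk'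
  · have test : ∀ c : ℕ, ¬ (m' : ℕ) ∣ c →
        kochOf (fun i => if i ≡ c [MOD m'] then 1 else 0) ∈ kochM β k m := by
      intro c hc
      refine h (mem_kochM_iff.2 ⟨?_, ?_⟩)
      · intro i hi
        have hmod : i + (m' : ℕ) ≡ c [MOD m'] ↔ i ≡ c [MOD m'] := by simp [Nat.ModEq]
        rw [kochTerm_of _ (by omega), kochTerm_of _ (by omega)]
        simp only [hmod]
      · rw [zero_add, kochTerm_zero, kochTerm_of _ hm', if_neg, mul_zero]
        intro h0
        exact hc (Nat.modEq_zero_iff_dvd.1 (h0.symm.trans (by simp [Nat.ModEq])))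
    have hdvd : (m' : ℕ) ∣ m := by
      by_cases h1 : (m' : ℕ) ∣ 1
      · exact h1.trans (one_dvd _)
      · obtain ⟨hT, -⟩ := mem_kochM_iff.1 (test 1 h1)
        have := hT (1 + m' * k) (by nlinarith)
        rw [kochTerm_of _ (by omega), kochTerm_of _ (by omega),
          if_pos (show 1 + (m' : ℕ) * k ≡ 1 [MOD m'] by simp [Nat.ModEq])] at this
        have h2 : 1 + (m' : ℕ) * k + m ≡ 1 [MOD m'] := by
          by_contra h3
          rw [if_neg h3] at this
          exact zero_ne_one this
        have h4 : 1 + (m : ℕ) ≡ 1 + 0 [MOD m'] := by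
          refine Nat.ModEq.trans ?_ h2
          rw [show 1 + (m' : ℕ) * k + m = 1 + m + m' * k by ring]
          simp [Nat.ModEq]
        exact Nat.modEq_zero_iff_dvd.1 (Nat.ModEq.add_left_cancel' 1 h4)
    refine ⟨hdvd, ?_⟩
    simp only
    by_contra! hcon
    have hk0 : 0 < k := Nat.pos_of_ne_zero (Ne.symm hcon.1)
    obtain ⟨-, hH⟩ := mem_kochM_iff.1 (test k (hcon.2 trivial))
    rw [kochTerm_of _ (by omega), kochTerm_of _ hk0, if_pos (Nat.ModEq.refl k),
      if_pos, mul_one] at hH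
    · exact hβ1 hH
    · obtain ⟨n, hn⟩ := hdvd
      rw [hn]
      simp [Nat.ModEq]
  · set f : ℕ → ℕ → ℂ := fun c i =>
      if k' < i ∧ i ≡ c [MOD m'] then 1 else if i = k' ∧ i ≡ c [MOD m'] then β else 0 with hf
    have test : ∀ c : ℕ, kochOf (f c) ∈ kochM β k m := by
      intro c
      refine h (mem_kochM_iff.2 ⟨?_, ?_⟩)
      · intro i hi
        rw [kochTerm_of _ (by omega), kochTerm_of _ (by omega)]
        have h1 : k' < i := by omega
        have h2 : k' < i + m' := by omega
        have h3 : i ≠ k' := by omega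
        have h4 : i + m' ≠ k' := by omega
        simp [hf, h1, h2, h3, h4, Nat.ModEq]
      · rw [kochTerm_of _ (by omega), kochTerm_of _ hk']
        simp [hf, Nat.ModEq]
    have hgt : ∀ c i, k' < i → f c i = if i ≡ c [MOD m'] then 1 else 0 := by
      intro c i hi
      have : i ≠ k' := by omega
      simp [hf, hi, this]
    obtain ⟨hT, -⟩ := mem_kochM_iff.1 (test k')
    have hle : k' ≤ k := by
      by_contra! hlt
      have := hT k' hlt
      rw [kochTerm_of _ (by omega), kochTerm_of _ hk', hgt _ _ (by omega)] at this
      have hfk : f k' k' = β := by simp [hf, Nat.ModEq]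
      rw [hfk] at this
      split_ifs at this
      · exact hβ1 this.symm
      · exact hβ0 this.symm
    have hdvd : (m' : ℕ) ∣ m := by
      have hlt : k' < k' + m' * (k + 1) := Nat.lt_add_of_pos_right (by positivity)
      have := hT (k' + m' * (k + 1)) (by nlinarith)
      rw [kochTerm_of _ (by omega), kochTerm_of _ (by omega), hgt _ _ (by omega), hgt _ _ hlt,
        if_pos (show k' + (m' : ℕ) * (k + 1) ≡ k' [MOD m'] by simp [Nat.ModEq])] at this
      have h2 : k' + (m' : ℕ) * (k + 1) + m ≡ k' [MOD m'] := by
        by_contra h3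
        rw [if_neg h3] at this
        exact zero_ne_one this
      have h4 : k' + (m : ℕ) ≡ k' + 0 [MOD m'] := by
        refine Nat.ModEq.trans ?_ h2
        rw [show k' + (m' : ℕ) * (k + 1) + m = k' + m + m' * (k + 1) by ring]
        simp [Nat.ModEq]
      exact Nat.modEq_zero_iff_dvd.1 (Nat.ModEq.add_left_cancel' k' h4)
    refine ⟨hdvd, Or.inl ?_⟩
    simp only
    by_contra hne
    have hlt : k' < k := by omega
    obtain ⟨-, hH⟩ := mem_kochM_iff.1 (test k)
    rw [kochTerm_of _ (by omega), kochTerm_of _ (by omega), hgt _ _ (by omega), hgt _ _ hlt,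
      if_pos (Nat.ModEq.refl k),
      if_pos, mul_one] at hH
    · exact hβ1 hH
    · obtain ⟨n, hn⟩ := hdvd
      rw [hn]
      simp [Nat.ModEq]

lemma kochHasType_kochQ {d : ℕ} (hd : 2 ≤ d) {β : ℂ} (hβ : β ^ d = 1) {k : ℕ} {m : ℕ+}
    {x : KochSeq} (hx : x ∈ kochM β k m) : KochHasType (kochQ d x) k m := by
  obtain ⟨hT, hH⟩ := mem_kochM_iff.1 hx
  intro i hi
  obtain ⟨j, rfl⟩ : ∃ j, i = j + 1 := ⟨i - 1, by omega⟩
  rw [show j + 1 + (m : ℕ) = (j + m) + 1 by ring, kochTerm_kochQ hd, kochTerm_kochQ hd]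
  rcases Nat.lt_or_ge k j with h | h
  · rw [hT j h]
  · obtain rfl : j = k := by omega
    rw [← hH, mul_pow, hβ, one_mul]

/-- On the sequences of type `(k',m')` the projections onto `H_{k,m}` and `H_{k',m'}` agree. -/
lemma kochProj_eq_of_kochLE {β : ℂ} (hβ1 : β ≠ 1) {k k' : ℕ} {m m' : ℕ+}
    (h : KochLE (k', m') (k, m)) {x : KochSeq} (hT : KochHasType x k' m') :
    kochProj β k m x = kochProj β k' m' x := by
  have hm' := m'.pos
  suffices kochShift β k m x = kochShift β k' m' x by
    funext i
    simp [kochProj, this]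
  obtain ⟨hm, hk⟩ := h
  simp only at hm hk
  obtain ⟨n, hn⟩ := hm
  obtain ⟨n, rfl⟩ : ∃ n', n = n' + 1 :=
    ⟨n - 1, by have := m.pos; rcases n with _ | n <;> simp_all⟩
  have hshift : ∀ j, k' ≤ j → kochTerm x (j + m) = kochTerm x (j + m') := by
    intro j hj
    rw [hn, mul_add, mul_one, add_comm (_ * n), ← add_assoc, hT.mul n _ (by omega)]
  unfold kochShift
  rcases hk with rfl | ⟨rfl, hk⟩
  · have := hshift 0
    simp only [zero_add] at this
    split_ifs with h0
    · exact this h0.le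
    · rw [hshift _ le_rfl]
  · rw [if_pos rfl]
    split_ifs with h0
    · have := hshift 0 le_rfl
      simpa using this
    · obtain ⟨a, rfl⟩ := hk
      obtain ⟨a, rfl⟩ : ∃ a', a = a' + 1 := ⟨a - 1, by rcases a with _ | a <;> simp_all⟩
      have h1 : kochTerm x (m' * (a + 1)) = kochTerm x m' := by
        rw [mul_add, mul_one, add_comm, hT.mul a _ (by omega)]
      rw [hshift _ (by omega), hT _ (by nlinarith), h1,
        div_eq_iff (sub_ne_zero.mpr hβ1)]
      ring

lemma mem_kochM_of_kochLE {β : ℂ} (hβ1 : β ≠ 1) {k k' : ℕ} {m m' : ℕ+}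
    (h : KochLE (k', m') (k, m)) {x : KochSeq} (hx : x ∈ kochM β k m) (hT : KochHasType x k' m') :
    x ∈ kochM β k' m' := by
  obtain ⟨-, hH⟩ := mem_kochM_iff.1 hx
  have hm := m.pos
  have hm' := m'.pos
  obtain ⟨⟨n, hn⟩, hk⟩ := h
  simp only at hn hk
  refine mem_kochM_iff.2 ⟨hT, ?_⟩
  obtain ⟨n, rfl⟩ : ∃ n', n = n' + 1 := ⟨n - 1, by rcases n with _ | n <;> simp_all⟩
  rcases hk with rfl | ⟨rfl, a, rfl⟩
  · rw [← hH, hn, mul_add, mul_one, add_comm (_ * n), ← add_assoc, hT.mul n _ (by omega)]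
  · have h0 : kochTerm x (m' * a) = 0 := by
      rcases a with _ | a
      · simp [kochTerm_zero]
      · have hper : kochTerm x (m' * (a + 1) + m) = kochTerm x (m' * (a + 1)) := by
          rw [hn]
          exact hT.mul _ _ (by nlinarith)
        rw [hper] at hH
        have : (β - 1) * kochTerm x (m' * (a + 1)) = 0 := by linear_combination hH
        exact (mul_eq_zero.1 this).resolve_left (sub_ne_zero.2 hβ1)
    have h1 : kochTerm x m' = kochTerm x (m' * a + m) := by
      rw [hn, ← mul_add, ← add_assoc, mul_add, mul_one, add_comm, hT.mul _ _ (by omega)]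
    have h2 : β * kochTerm x m' = 0 := by rw [h1, hH, h0]
    rw [zero_add, h2, kochTerm_zero]

lemma kochMap_eqOn_of_kochLE {d : ℕ} (hd : 2 ≤ d) {β : ℂ} (hβ : β ^ d = 1) (hβ1 : β ≠ 1)
    {k k' : ℕ} {m m' : ℕ+} (h : KochLE (k', m') (k, m)) :
    Set.EqOn (kochMap d β k m) (kochMap d β k' m') (kochM β k' m') :=
  fun _ hx => kochProj_eq_of_kochLE hβ1 h (kochHasType_kochQ hd hβ hx)

lemma kochLE_iff {d : ℕ} (hd : 2 ≤ d) {β : ℂ} (hβ : β ^ d = 1) (hβ1 : β ≠ 1)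
    (k : ℕ) (m : ℕ+) (k' : ℕ) (m' : ℕ+) :
    KochLE (k', m') (k, m) ↔
      kochM β k' m' ≤ kochM β k m ∧
      Set.MapsTo (kochMap d β k m) (kochM β k' m') (kochM β k' m') ∧
      Set.EqOn (kochMap d β k m) (kochMap d β k' m') (kochM β k' m') := by
  have hβ0 := beta_ne_zero hd hβ
  refine ⟨fun h => ⟨kochM_le_of_kochLE hβ0 h, ?_, kochMap_eqOn_of_kochLE hd hβ hβ1 h⟩,
    fun h => kochLE_of_kochM_le hβ0 hβ1 h.1⟩
  intro x hx
  rw [kochMap_eqOn_of_kochLE hd hβ hβ1 h hx]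
  exact kochMap_mem hd hβ hβ1 k' m' hx

end

noncomputable section

/-! ### The derivative of `F_{k,m}` -/

/-- The continuous linear form `x ↦ x_i`, with `x_0 = 0`. -/
def kochTermL (i : ℕ) : KochSeq →L[ℂ] ℂ :=
  if h : 0 < i then ContinuousLinearMap.proj (i.toPNat h) else 0

lemma kochTermL_apply (i : ℕ) (x : KochSeq) : kochTermL i x = kochTerm x i := by
  unfold kochTermL kochTerm
  split_ifs <;> simp

/-- The linear form `kochShift`, as a continuous linear form. -/
def kochShiftL (β : ℂ) (k : ℕ) (m : ℕ+) : KochSeq →L[ℂ] ℂ :=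
  if k = 0 then kochTermL m else (β - 1)⁻¹ • (β • kochTermL (k + m) - kochTermL k)

lemma kochShiftL_apply (β : ℂ) (k : ℕ) (m : ℕ+) (x : KochSeq) :
    kochShiftL β k m x = kochShift β k m x := by
  unfold kochShiftL kochShift
  split_ifs
  · exact kochTermL_apply _ _
  · simp [kochTermL_apply, div_eq_inv_mul]

/-- The projection `kochProj` onto `H_{k,m}`, as a continuous linear map. -/
def kochProjL (β : ℂ) (k : ℕ) (m : ℕ+) : KochSeq →L[ℂ] KochSeq :=
  ContinuousLinearMap.pi fun i => ContinuousLinearMap.proj i - kochShiftL β k m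

lemma kochProjL_apply (β : ℂ) (k : ℕ) (m : ℕ+) (x : KochSeq) :
    kochProjL β k m x = kochProj β k m x := by
  funext i
  simp [kochProjL, kochProj, kochShiftL_apply]

/-- The derivative of `Q` at `z`: the `i`-th entry of the image of `v` is
`d z_{i-1}^{d-1} v_{i-1}`. -/
def kochDQ (d : ℕ) (z : KochSeq) : KochSeq →L[ℂ] KochSeq :=
  ContinuousLinearMap.pi fun i : ℕ+ =>
    (d * kochTerm z ((i : ℕ) - 1) ^ (d - 1) : ℂ) • kochTermL ((i : ℕ) - 1)

lemma kochTerm_kochDQ (d : ℕ) (z v : KochSeq) (i : ℕ) :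
    kochTerm (kochDQ d z v) (i + 1) = d * kochTerm z i ^ (d - 1) * kochTerm v i := by
  rw [kochTerm_of_pos _ (Nat.succ_pos i)]
  change _ * kochTermL (i + 1 - 1) v = _
  rw [kochTermL_apply]
  rfl

open Asymptotics Filter Topology

lemma hasFDerivAt_kochQ {d : ℕ} (hd : 2 ≤ d) (z : KochSeq) :
    HasFDerivAt (kochQ d) (kochDQ d z) z := by
  rw [hasFDerivAt_iff_isLittleOTVS, isLittleOTVS_pi]
  intro i
  have h1 : HasFDerivAt (fun t : ℂ => t ^ d) _ (kochTermL ((i : ℕ) - 1) z) :=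
    (hasDerivAt_pow d (kochTermL ((i : ℕ) - 1) z)).hasFDerivAt
  have h2 := (hasFDerivAt_iff_isLittleOTVS.1 h1).comp_tendsto
    ((kochTermL ((i : ℕ) - 1)).continuous.tendsto z)
  have h3 : (fun x : KochSeq => kochTermL ((i : ℕ) - 1) (x - z)) =O[ℂ; 𝓝 z] fun x => x - z :=
    (kochTermL ((i : ℕ) - 1)).isBigOTVS_fun_comp
  refine (h2.trans_isBigOTVS (h3.congr_left fun x => by simp)).congr_left fun x => ?_
  have hQ : ∀ y : KochSeq, kochQ d y i = kochTerm y ((i : ℕ) - 1) ^ d := by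
    intro y
    have := kochTerm_kochQ hd y ((i : ℕ) - 1)
    rwa [Nat.sub_add_cancel i.pos, kochTerm_coe] at this
  have hD : ∀ v : KochSeq, kochDQ d z v i =
      d * kochTerm z ((i : ℕ) - 1) ^ (d - 1) * kochTerm v ((i : ℕ) - 1) := by
    intro y
    have := kochTerm_kochDQ d z y ((i : ℕ) - 1)
    rwa [Nat.sub_add_cancel i.pos, kochTerm_coe] at this
  simp only [Function.comp, Pi.sub_apply, hQ, hD, kochTermL_apply, sub_right_inj]
  simp only [← kochTermL_apply, map_sub]
  simp only [ContinuousLinearMap.toSpanSingleton_apply, smul_eq_mul]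
  ring

lemma hasFDerivAt_kochMap {d : ℕ} (hd : 2 ≤ d) (β : ℂ) (k : ℕ) (m : ℕ+) (z : KochSeq) :
    HasFDerivAt (kochMap d β k m) (kochProjL β k m ∘L kochDQ d z) z := by
  rw [hasFDerivAt_iff_isLittleOTVS]
  have h := hasFDerivAt_iff_isLittleOTVS.1 (hasFDerivAt_kochQ hd z)
  refine ((kochProjL β k m).isBigOTVS_fun_comp.trans_isLittleOTVS h).congr_left fun x => ?_
  simp [map_sub, kochProjL_apply, kochMap]

lemma kochProj_mem_kochM {β : ℂ} (hβ1 : β ≠ 1) {k : ℕ} {m : ℕ+} {x : KochSeq}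
    (hx : KochHasType x k m) : kochProj β k m x ∈ kochM β k m := by
  refine ⟨fun i hi => ?_, kochProj_mem hβ1 k m x⟩
  rw [kochTerm_proj _ _ _ _ (by omega), kochTerm_proj _ _ _ _ (by omega), hx i hi]

/-- As `β ^ d = 1`, the relation `z_k = β z_{k+m}` turns into the opposite one for the derivatives
of `t ↦ t ^ d` at `z_k` and `z_{k+m}`. So their products with `v_k = β v_{k+m}` and `v_{k+m}`
agree. -/
lemma pow_pred_eq_of_mem_kochM {d : ℕ} (hd : 2 ≤ d) {β : ℂ} (hβ : β ^ d = 1) {k : ℕ} {m : ℕ+}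
    {z : KochSeq} (hz : z ∈ kochM β k m) :
    kochTerm z (k + m) ^ (d - 1) = β * kochTerm z k ^ (d - 1) := by
  rw [← (mem_kochM_iff.1 hz).2, mul_pow, ← mul_assoc, ← pow_succ',
    Nat.sub_add_cancel (by omega), hβ, one_mul]

lemma kochHasType_kochDQ {d : ℕ} (hd : 2 ≤ d) {β : ℂ} (hβ : β ^ d = 1) {k : ℕ} {m : ℕ+}
    {z v : KochSeq} (hz : z ∈ kochM β k m) (hv : v ∈ kochM β k m) :
    KochHasType (kochDQ d z v) k m := by
  intro i hi
  obtain ⟨j, rfl⟩ : ∃ j, i = j + 1 := ⟨i - 1, by omega⟩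
  rw [show j + 1 + (m : ℕ) = (j + m) + 1 by ring, kochTerm_kochDQ, kochTerm_kochDQ]
  rcases Nat.lt_or_ge k j with h | h
  · rw [(mem_kochM_iff.1 hz).1 j h, (mem_kochM_iff.1 hv).1 j h]
  · obtain rfl : j = k := by omega
    rw [pow_pred_eq_of_mem_kochM hd hβ hz, ← (mem_kochM_iff.1 hv).2]
    ring

/-- The derivative of `F_{k,m}` at `z`, as a continuous endomorphism of `M_{k,m}`. -/
def kochDL {d : ℕ} (hd : 2 ≤ d) {β : ℂ} (hβ : β ^ d = 1) (hβ1 : β ≠ 1) (k : ℕ) (m : ℕ+)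
    (z : kochM β k m) : kochM β k m →L[ℂ] kochM β k m :=
  ((kochProjL β k m ∘L kochDQ d z) ∘L (kochM β k m).subtypeL).codRestrict (kochM β k m) fun v => by
    simpa [kochProjL_apply] using kochProj_mem_kochM hβ1 (kochHasType_kochDQ hd hβ z.2 v.2)

/-- The space `M_{k,m}` carries only its subspace topology, so the derivative is computed in the
space of all sequences and then pulled back along the inclusion. -/
lemma hasFDerivAt_kochF {d : ℕ} (hd : 2 ≤ d) {β : ℂ} (hβ : β ^ d = 1) (hβ1 : β ≠ 1) (k : ℕ)
    (m : ℕ+) (z : kochM β k m) :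
    HasFDerivAt (kochF hd hβ hβ1 k m) (kochDL hd hβ hβ1 k m z) z := by
  rw [hasFDerivAt_iff_isLittleOTVS]
  have h := (hasFDerivAt_iff_isLittleOTVS.1 (hasFDerivAt_kochMap hd β k m z)).comp_tendsto
    (continuous_subtype_val.tendsto z)
  have h1 : (fun x : kochM β k m => (kochM β k m).subtypeL (x - z)) =O[ℂ; 𝓝 z] fun x => x - z :=
    (kochM β k m).subtypeL.isBigOTVS_fun_comp
  refine ((kochM β k m).subtypeL.isThetaTVS_comp
    Topology.IsInducing.subtypeVal).2.trans_isLittleOTVS ?_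
  refine IsLittleOTVS.congr_left (h.trans_isBigOTVS h1) fun x => ?_
  rfl

lemma differentiable_kochF {d : ℕ} (hd : 2 ≤ d) {β : ℂ} (hβ : β ^ d = 1) (hβ1 : β ≠ 1) (k : ℕ)
    (m : ℕ+) : Differentiable ℂ (kochF hd hβ hβ1 k m) :=
  fun z => ⟨_, hasFDerivAt_kochF hd hβ hβ1 k m z⟩

lemma coe_kochD_apply {d : ℕ} (hd : 2 ≤ d) {β : ℂ} (hβ : β ^ d = 1) (hβ1 : β ≠ 1) (k : ℕ) (m : ℕ+)
    (z v : kochM β k m) :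
    (kochD hd hβ hβ1 k m z v : KochSeq) = kochProj β k m (kochDQ d z v) := by
  rw [kochD, (hasFDerivAt_kochF hd hβ hβ1 k m z).fderiv, ← kochProjL_apply]
  rfl

lemma kochTerm_kochD {d : ℕ} (hd : 2 ≤ d) {β : ℂ} (hβ : β ^ d = 1) (hβ1 : β ≠ 1) (k : ℕ) (m : ℕ+)
    (z v : kochM β k m) (i : ℕ) :
    kochTerm (kochD hd hβ hβ1 k m z v) (i + 1) =
      d * kochTerm z i ^ (d - 1) * kochTerm v i - kochShift β k m (kochDQ d z v) := by
  rw [coe_kochD_apply, kochTerm_proj _ _ _ _ (Nat.succ_pos i), kochTerm_kochDQ]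

/-! ### Linear coordinates and the conjugacy with `G_{k,m}` -/

lemma kochCoord_zero {n : ℕ} (x : Fin n → ℂ) : kochCoord x 0 = 0 := by simp [kochCoord]

lemma kochCoord_succ {n : ℕ} (x : Fin n → ℂ) (j : Fin n) : kochCoord x (j + 1) = x j := by
  have : (j : ℕ) + 1 ≤ n := j.2
  simp [kochCoord, this]

/-- The linear coordinates `(x_1, …, x_{m-1})` on `M_{0,m}`. -/
def kochCoordsZero (β : ℂ) (m : ℕ+) : kochM β 0 m →ₗ[ℂ] (Fin (0 + m - 1) → ℂ) where
  toFun x j := kochTerm x (j + 1)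
  map_add' x y := by funext j; exact kochTerm_add _ _ _
  map_smul' c x := by funext j; exact kochTerm_smul _ _ _

lemma kochCoordsZero_bijective {β : ℂ} (hβ0 : β ≠ 0) (m : ℕ+) :
    Function.Bijective (kochCoordsZero β m) := by
  have hm := m.pos
  constructor
  · rw [injective_iff_map_eq_zero]
    intro x hx
    obtain ⟨hT, -⟩ := mem_kochM_iff.1 x.2
    have h0 : ∀ i, i < (m : ℕ) → kochTerm x i = 0 := by
      intro i hi
      rcases i with _ | i
      · exact kochTerm_zero _
      · exact congrFun hx ⟨i, by omega⟩
    refine Subtype.ext (kochSeq_ext fun i hi => ?_)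
    rw [show kochTerm ((0 : kochM β 0 m) : KochSeq) i = 0 by simp [kochTerm]]
    by_cases hd : (m : ℕ) ∣ i
    · exact kochTerm_eq_zero_of_dvd hβ0 x.2 hd
    · have : 0 < i % m := Nat.pos_of_ne_zero fun h => hd (Nat.dvd_of_mod_eq_zero h)
      rw [← Nat.mod_add_div i m, hT.mul _ _ (by omega), h0 _ (Nat.mod_lt _ hm)]
  · intro f
    refine ⟨⟨kochOf fun i => kochCoord f (i % m), mem_kochM_iff.2 ⟨?_, ?_⟩⟩, ?_⟩
    · intro i hi
      rw [kochTerm_of _ (by omega), kochTerm_of _ (by omega), Nat.add_mod_right]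
    · rw [kochTerm_zero, kochTerm_of _ (by omega), Nat.add_mod_right, Nat.zero_mod, kochCoord_zero,
        mul_zero]
    · funext j
      have hj := j.2
      change kochTerm (kochOf fun i => kochCoord f (i % m)) (j + 1) = f j
      rw [kochTerm_of _ (Nat.succ_pos _), Nat.mod_eq_of_lt (by omega), kochCoord_succ]

/-- The linear coordinates `(x_2 - x_1, …, x_{k+m} - x_1)` on `M_{k,m}`, for `k ≥ 1`. -/
def kochCoordsPos (β : ℂ) (k : ℕ) (m : ℕ+) : kochM β k m →ₗ[ℂ] (Fin (k + m - 1) → ℂ) where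
  toFun x j := kochTerm x (j + 2) - kochTerm x 1
  map_add' x y := by
    funext j
    simp only [Submodule.coe_add, kochTerm_add, Pi.add_apply]
    ring
  map_smul' c x := by
    funext j
    simp only [Submodule.coe_smul, kochTerm_smul, Pi.smul_apply, smul_eq_mul, RingHom.id_apply]
    ring

lemma kochCoord_kochCoordsPos (β : ℂ) (k : ℕ) (m : ℕ+) (x : kochM β k m) {i : ℕ}
    (hi : i ≤ k + m - 1) :
    kochCoord (kochCoordsPos β k m x) i = kochTerm x (i + 1) - kochTerm x 1 := by
  rcases i with _ | i
  · simp [kochCoord_zero]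
  · exact kochCoord_succ (kochCoordsPos β k m x) ⟨i, by omega⟩

/-- The index in `{1, …, k + m}` carrying the same term as the index `i` in every sequence of
type `(k, m)`. -/
def kochIndex (k : ℕ) (m : ℕ) (i : ℕ) : ℕ := if i ≤ k then i else k + 1 + (i - k - 1) % m

lemma kochIndex_le (k : ℕ) {m : ℕ} (hm : 0 < m) (i : ℕ) : kochIndex k m i ≤ k + m := by
  have := Nat.mod_lt (i - k - 1) hm
  unfold kochIndex
  split_ifs <;> omega

lemma kochIndex_pos (k m : ℕ) {i : ℕ} (hi : 0 < i) : 0 < kochIndex k m i := by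
  unfold kochIndex
  split_ifs <;> omega

lemma kochIndex_of_le {k m i : ℕ} (hi : i ≤ k + m) : kochIndex k m i = i := by
  unfold kochIndex
  split_ifs with h
  · rfl
  · rw [Nat.mod_eq_of_lt] <;> omega

lemma kochIndex_add {k m i : ℕ} (hi : k + 1 ≤ i) : kochIndex k m (i + m) = kochIndex k m i := by
  unfold kochIndex
  rw [if_neg (by omega), if_neg (by omega), show i + m - k - 1 = i - k - 1 + m by omega,
    Nat.add_mod_right]

lemma KochHasType.kochTerm_kochIndex {x : KochSeq} {k m : ℕ} (h : KochHasType x k m) (i : ℕ) :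
    kochTerm x (kochIndex k m i) = kochTerm x i := by
  unfold kochIndex
  split_ifs with hi
  · rfl
  · rw [← h.mul ((i - k - 1) / m) _ (by omega), add_assoc, Nat.mod_add_div]
    congr 1
    omega

lemma kochHasType_kochOf_kochIndex (k m : ℕ) (f : ℕ → ℂ) :
    KochHasType (kochOf fun i => f (kochIndex k m i)) k m := by
  intro i hi
  rw [kochTerm_of _ (by omega), kochTerm_of _ (by omega), kochIndex_add hi]

lemma kochCoordsPos_bijective {β : ℂ} (hβ1 : β ≠ 1) {k : ℕ} (hk : 0 < k) (m : ℕ+) :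
    Function.Bijective (kochCoordsPos β k m) := by
  have hm := m.pos
  constructor
  · rw [injective_iff_map_eq_zero]
    intro x hx
    obtain ⟨hT, hH⟩ := mem_kochM_iff.1 x.2
    have h1 : ∀ i, 0 < i → kochTerm x i = kochTerm x 1 := by
      intro i hi
      have hle := kochIndex_le k hm i
      have hpos := kochIndex_pos k m hi
      have := kochCoord_kochCoordsPos β k m x (i := kochIndex k m i - 1) (by omega)
      rw [hx, Nat.sub_add_cancel hpos, hT.kochTerm_kochIndex] at this
      rw [← sub_eq_zero, ← this]
      simp [kochCoord]
    have h2 : kochTerm x 1 = 0 := by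
      rw [h1 _ hk, h1 _ (by omega)] at hH
      have : (β - 1) * kochTerm x 1 = 0 := by linear_combination hH
      exact (mul_eq_zero.1 this).resolve_left (sub_ne_zero.2 hβ1)
    refine Subtype.ext (kochSeq_ext fun i hi => ?_)
    rw [h1 i hi, h2]
    simp [kochTerm]
  · intro f
    have hT := kochHasType_kochOf_kochIndex k m fun i => kochCoord f (i - 1)
    refine ⟨⟨_, kochProj_mem_kochM hβ1 hT⟩, ?_⟩
    funext j
    have hj := j.2
    change kochTerm (kochProj β k m _) (j + 2) - kochTerm (kochProj β k m _) 1 = f j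
    rw [kochTerm_proj _ _ _ _ (by omega), kochTerm_proj _ _ _ _ (by omega),
      kochTerm_of _ (by omega), kochTerm_of _ (by omega), kochIndex_of_le (by omega),
      kochIndex_of_le (by omega), Nat.sub_self, kochCoord_zero,
      show (j : ℕ) + 2 - 1 = j + 1 by omega, kochCoord_succ]
    ring

lemma exists_linearEquiv_kochM {β : ℂ} (hβ0 : β ≠ 0) (hβ1 : β ≠ 1) (k : ℕ) (m : ℕ+) :
    Nonempty (kochM β k m ≃ₗ[ℂ] (Fin (k + m - 1) → ℂ)) := by
  rcases Nat.eq_zero_or_pos k with rfl | hk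
  · exact ⟨LinearEquiv.ofBijective _ (kochCoordsZero_bijective hβ0 m)⟩
  · exact ⟨LinearEquiv.ofBijective _ (kochCoordsPos_bijective hβ1 hk m)⟩

lemma finiteDimensional_kochM {β : ℂ} (hβ0 : β ≠ 0) (hβ1 : β ≠ 1) (k : ℕ) (m : ℕ+) :
    FiniteDimensional ℂ (kochM β k m) :=
  (exists_linearEquiv_kochM hβ0 hβ1 k m).some.symm.finiteDimensional

lemma holomorphicallyConjugate_of_linearEquiv {V : Type*} [AddCommGroup V] [Module ℂ V]
    [TopologicalSpace V] [IsTopologicalAddGroup V] [ContinuousSMul ℂ V] [T2Space V] {n : ℕ}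
    (e : V ≃ₗ[ℂ] (Fin n → ℂ)) {f : V → V} {g : (Fin n → ℂ) → Fin n → ℂ}
    (h : ∀ x, e (f x) = g (e x)) : HolomorphicallyConjugate f g := by
  have : FiniteDimensional ℂ V := e.symm.finiteDimensional
  let φ : V ≃L[ℂ] (Fin n → ℂ) := e.toContinuousLinearEquiv
  exact ⟨φ.toEquiv, (φ : V →L[ℂ] (Fin n → ℂ)).differentiable,
    (φ.symm : (Fin n → ℂ) →L[ℂ] V).differentiable, h⟩

/-- For `k = 0` the coordinates `x_1, …, x_{m-1}` conjugate `F_{k,m}` to `G_{k,m}`. For `k ≥ 1`,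
`G_{k,m}` is `Q ∘ π` read in the coordinates `y_2, …, y_{k+m}` on the preperiodic sequences `y` with
`y_1 = 0`, and the inverse `x ↦ x - x_1` of `π` conjugates `π ∘ Q` to `Q ∘ π`. -/
lemma kochF_conjugate_kochG {d : ℕ} (hd : 2 ≤ d) {β : ℂ} (hβ : β ^ d = 1) (hβ1 : β ≠ 1) (k : ℕ)
    (m : ℕ+) : HolomorphicallyConjugate (kochF hd hβ hβ1 k m) (kochG d β k m) := by
  have hβ0 := beta_ne_zero hd hβ
  have hm := m.pos
  rcases Nat.eq_zero_or_pos k with rfl | hk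
  · refine holomorphicallyConjugate_of_linearEquiv
      (LinearEquiv.ofBijective _ (kochCoordsZero_bijective hβ0 m)) fun x => ?_
    have hc : ∀ i ≤ (m : ℕ) - 1, kochCoord (kochCoordsZero β m x) i = kochTerm x i := by
      intro i hi
      rcases i with _ | i
      · rw [kochCoord_zero, kochTerm_zero]
      · exact kochCoord_succ (kochCoordsZero β m x) ⟨i, by omega⟩
    funext j
    have hj := j.2
    change kochTerm (kochProj β 0 m (kochQ d x)) (j + 1) = kochG d β 0 m (kochCoordsZero β m x) j
    have hs : kochTerm (kochQ d x) m = kochTerm x (m - 1) ^ d := by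
      rw [← kochTerm_kochQ hd, Nat.sub_add_cancel hm]
    rw [kochG, if_pos rfl, hc _ (by omega), hc _ le_rfl, kochTerm_proj _ _ _ _ (by omega),
      kochShift, if_pos rfl, hs, kochTerm_kochQ hd]
  · refine holomorphicallyConjugate_of_linearEquiv
      (LinearEquiv.ofBijective _ (kochCoordsPos_bijective hβ1 hk m)) fun x => ?_
    have hH := (mem_kochM_iff.1 x.2).2
    funext j
    have hj := j.2
    change kochTerm (kochProj β k m (kochQ d x)) (j + 2) - kochTerm (kochProj β k m (kochQ d x)) 1 =
      kochG d β k m (kochCoordsPos β k m x) j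
    have h1 : kochTerm (kochQ d x) 1 = 0 := by
      have := kochTerm_kochQ hd (x : KochSeq) 0
      rwa [kochTerm_zero, zero_pow (by omega), zero_add] at this
    rw [kochG, if_neg hk.ne', kochCoord_kochCoordsPos _ _ _ _ (by omega),
      kochCoord_kochCoordsPos _ _ _ _ le_rfl, kochCoord_kochCoordsPos _ _ _ _ (by omega),
      kochTerm_proj _ _ _ _ (by omega), kochTerm_proj _ _ _ _ (by omega),
      kochTerm_kochQ hd _ ((j : ℕ) + 1), h1, Nat.sub_add_cancel hk,
      Nat.sub_add_cancel (show 1 ≤ k + (m : ℕ) by omega)]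
    have hβ' := sub_ne_zero.2 hβ1
    have : kochTerm x (j + 1) = kochTerm x (j + 1) - kochTerm x 1 -
        (β * (kochTerm x (k + m) - kochTerm x 1) - (kochTerm x k - kochTerm x 1)) / (β - 1) := by
      field_simp
      linear_combination hH
    rw [← this]
    ring

end

noncomputable section

/-! ### Push-forward of quadratic differentials under `t ↦ t ^ d + c` -/

open MeasureTheory ENNReal

lemma sum_primitiveRoot_pow {d : ℕ} {ζ : ℂ} (hζ : IsPrimitiveRoot ζ d) (n : ℕ) :
    ∑ j ∈ Finset.range d, (ζ ^ j) ^ n = if d ∣ n then (d : ℂ) else 0 := by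
  split_ifs with h
  · obtain ⟨a, rfl⟩ := h
    have : ∀ j ∈ Finset.range d, (ζ ^ j) ^ (d * a) = 1 := by
      intro j _
      rw [← pow_mul, mul_left_comm, pow_mul, hζ.pow_eq_one, one_pow]
    rw [Finset.sum_congr rfl this]
    simp
  · have h1 : ζ ^ n ≠ 1 := fun h1 => h (hζ.dvd_of_pow_eq_one n h1)
    have h2 : ∑ j ∈ Finset.range d, (ζ ^ j) ^ n = ∑ j ∈ Finset.range d, (ζ ^ n) ^ j :=
      Finset.sum_congr rfl fun j _ => by rw [← pow_mul, ← pow_mul, mul_comm]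
    rw [h2, geom_sum_eq h1, ← pow_mul, mul_comm, pow_mul, hζ.pow_eq_one, one_pow, sub_self,
      zero_div]

/-- The partial fraction expansion of `a d y^{d-2} / (y^d - a^d)` at the `d`-th roots of `a^d`. -/
lemma sum_primitiveRoot_sq_div {d : ℕ} (hd : 2 ≤ d) {ζ : ℂ} (hζ : IsPrimitiveRoot ζ d) {y a : ℂ}
    (h : y ^ d ≠ a ^ d) :
    ∑ j ∈ Finset.range d, (ζ ^ j) ^ 2 / (ζ ^ j * y - a) =
      d * a * y ^ (d - 2) / (y ^ d - a ^ d) := by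
  have hne : y ^ d - a ^ d ≠ 0 := sub_ne_zero.2 h
  have h1 : ∀ j ∈ Finset.range d, (ζ ^ j) ^ 2 / (ζ ^ j * y - a) =
      (∑ l ∈ Finset.range d, (ζ ^ j) ^ (l + 2) * (y ^ l * a ^ (d - 1 - l))) / (y ^ d - a ^ d) := by
    intro j _
    have h2 : (ζ ^ j * y) ^ d = y ^ d := by
      rw [mul_pow, ← pow_mul, mul_comm j, pow_mul, hζ.pow_eq_one, one_pow, one_mul]
    have h3 := (Commute.all (ζ ^ j * y) a).geom_sum₂_mul d
    rw [h2] at h3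
    have h4 : ζ ^ j * y - a ≠ 0 := by
      intro h0
      rw [h0, mul_zero] at h3
      exact hne h3.symm
    rw [div_eq_div_iff h4 hne, ← h3, ← mul_assoc, Finset.mul_sum]
    congr 1
    refine Finset.sum_congr rfl fun l _ => ?_
    ring
  rw [Finset.sum_congr rfl h1, ← Finset.sum_div, Finset.sum_comm]
  congr 1
  simp_rw [← Finset.sum_mul, sum_primitiveRoot_pow hζ]
  rw [Finset.sum_eq_single (d - 2)]
  · rw [Nat.sub_add_cancel hd, if_pos dvd_rfl, show d - 1 - (d - 2) = 1 by omega]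
    ring
  · intro l hl hne'
    have hl' := Finset.mem_range.1 hl
    rw [if_neg, zero_mul]
    rintro ⟨e, he⟩
    rcases e with _ | _ | e
    · omega
    · omega
    · nlinarith
  · intro hl
    exact absurd (Finset.mem_range.2 (by omega)) hl

/-- The push-forward of `dt² / (t - a)` under `P(t) = t ^ d + c`, evaluated at `P(y)`: it is
`(1 / (w - P(a)) - 1 / (w - c)) / P'(a)`. For `a = 0` both sides vanish. -/
lemma sum_pushforward_inv_sub {d : ℕ} (hd : 2 ≤ d) {ζ : ℂ} (hζ : IsPrimitiveRoot ζ d) {y a : ℂ}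
    (hy : y ≠ 0) (h : y ^ d ≠ a ^ d) (c : ℂ) :
    ∑ j ∈ Finset.range d, (ζ ^ j * y - a)⁻¹ / (d * (ζ ^ j * y) ^ (d - 1)) ^ 2 =
      ((y ^ d + c - (a ^ d + c))⁻¹ - (y ^ d + c - c)⁻¹) / (d * a ^ (d - 1)) := by
  have hd0 : (d : ℂ) ≠ 0 := Nat.cast_ne_zero.2 (by omega)
  have hne : y ^ d - a ^ d ≠ 0 := sub_ne_zero.2 h
  have hyd : y ^ d ≠ 0 := pow_ne_zero _ hy
  have h1 : ∀ j ∈ Finset.range d, (ζ ^ j * y - a)⁻¹ / (d * (ζ ^ j * y) ^ (d - 1)) ^ 2 =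
      (ζ ^ j) ^ 2 / (ζ ^ j * y - a) * (d * y ^ (d - 1))⁻¹ ^ 2 := by
    intro j _
    have hu : (ζ ^ j) ^ (d - 1) * ζ ^ j = 1 := by
      rw [← pow_succ, Nat.sub_add_cancel (by omega), ← pow_mul, mul_comm, pow_mul, hζ.pow_eq_one,
        one_pow]
    have hu' : (ζ ^ j) ^ (d - 1) = (ζ ^ j)⁻¹ := eq_inv_of_mul_eq_one_left hu
    rw [mul_pow (ζ ^ j), hu', div_eq_mul_inv, div_eq_mul_inv, ← inv_pow]
    simp only [mul_inv, inv_inv]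
    ring
  rw [Finset.sum_congr rfl h1, ← Finset.sum_mul, sum_primitiveRoot_sq_div hd hζ h]
  rcases eq_or_ne a 0 with rfl | ha
  · simp [zero_pow (show d - 1 ≠ 0 by omega)]
  · have e1 : y ^ d = y ^ (d - 2) * y ^ 2 := by rw [← pow_add, Nat.sub_add_cancel hd]
    have e2 : y ^ (d - 1) = y ^ (d - 2) * y := by
      rw [← pow_succ]; congr 1; omega
    have e3 : a ^ d = a ^ (d - 1) * a := by rw [← pow_succ, Nat.sub_add_cancel (by omega)]
    have hy2 : y ^ (d - 2) ≠ 0 := pow_ne_zero _ hy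
    have ha1 : a ^ (d - 1) ≠ 0 := pow_ne_zero _ ha
    rw [add_sub_add_right_eq_sub, add_sub_cancel_right]
    rw [e1, e3] at hne ⊢
    rw [e2]
    rw [inv_sub_inv hne (mul_ne_zero hy2 (pow_ne_zero 2 hy)), _root_.sub_sub_cancel]
    generalize y ^ (d - 2) * y ^ 2 - a ^ (d - 1) * a = D at *
    field_simp

lemma lintegral_ball_inv_norm_lt_top (r : ℝ) :
    ∫⁻ w in Metric.ball (0 : ℂ) r, ‖w⁻¹‖ₑ < ∞ := by
  rw [← lintegral_indicator measurableSet_ball, ← Complex.lintegral_comp_polarCoord_symm]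
  calc _ ≤ ∫⁻ p in polarCoord.target,
        (Set.Ioo (0 : ℝ) r ×ˢ Set.Ioo (-Real.pi) Real.pi).indicator (fun _ => (1 : ℝ≥0∞)) p := by
        refine setLIntegral_mono_ae' polarCoord.open_target.measurableSet
          (.of_forall fun p hp => ?_)
        rw [polarCoord_target] at hp
        have hp0 : 0 < p.1 := hp.1
        have hn : ‖Complex.polarCoord.symm p‖ = p.1 := by
          rw [Complex.norm_polarCoord_symm, abs_of_pos hp0]
        by_cases hpr : p.1 < r
        · have hmem : p ∈ Set.Ioo (0 : ℝ) r ×ˢ Set.Ioo (-Real.pi) Real.pi := ⟨⟨hp0, hpr⟩, hp.2⟩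
          rw [Set.indicator_of_mem (by rwa [mem_ball_zero_iff, hn]),
            Set.indicator_of_mem hmem,
            ← ofReal_norm, norm_inv, hn, smul_eq_mul, ← ENNReal.ofReal_mul hp0.le,
            mul_inv_cancel₀ hp0.ne', ENNReal.ofReal_one]
        · rw [Set.indicator_of_notMem (by rwa [mem_ball_zero_iff, hn])]
          simp
    _ ≤ ∫⁻ p, (Set.Ioo (0 : ℝ) r ×ˢ Set.Ioo (-Real.pi) Real.pi).indicator
        (fun _ => (1 : ℝ≥0∞)) p := setLIntegral_le_lintegral _ _
    _ < ∞ := by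
        rw [lintegral_indicator_const (measurableSet_Ioo.prod measurableSet_Ioo), one_mul,
          Measure.volume_eq_prod, Measure.prod_prod, Real.volume_Ioo, Real.volume_Ioo]
        exact ENNReal.mul_lt_top ENNReal.ofReal_lt_top ENNReal.ofReal_lt_top

/-- Simple poles are integrable with respect to area. -/
lemma lintegral_ball_inv_sub_lt_top (a : ℂ) (r : ℝ) :
    ∫⁻ w in Metric.ball (0 : ℂ) r, ‖(w - a)⁻¹‖ₑ < ∞ := by
  refine lt_of_le_of_lt ?_ (lintegral_ball_inv_norm_lt_top (r + ‖a‖))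
  rw [← lintegral_indicator measurableSet_ball, ← lintegral_indicator measurableSet_ball,
    ← lintegral_sub_right_eq_self (μ := volume)
      (Set.indicator (Metric.ball (0 : ℂ) (r + ‖a‖)) fun w => ‖w⁻¹‖ₑ) a]
  refine lintegral_mono fun w => ?_
  by_cases hw : w ∈ Metric.ball (0 : ℂ) r
  · have : w - a ∈ Metric.ball (0 : ℂ) (r + ‖a‖) := by
      rw [mem_ball_zero_iff] at hw ⊢
      linarith [norm_sub_le w a]
    rw [Set.indicator_of_mem hw, Set.indicator_of_mem this]
  · rw [Set.indicator_of_notMem hw]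
    exact zero_le

lemma lintegral_ball_sum_lt_top {ι : Type*} (s : Finset ι) (ρ a : ι → ℂ) (r : ℝ) :
    ∫⁻ w in Metric.ball (0 : ℂ) r, ‖∑ i ∈ s, ρ i * (w - a i)⁻¹‖ₑ < ∞ := by
  calc _ ≤ ∫⁻ w in Metric.ball (0 : ℂ) r, ∑ i ∈ s, ‖ρ i‖ₑ * ‖(w - a i)⁻¹‖ₑ := by
        refine lintegral_mono fun w => (enorm_sum_le _ _).trans (le_of_eq ?_)
        simp [enorm_mul]
    _ = ∑ i ∈ s, ‖ρ i‖ₑ * ∫⁻ w in Metric.ball (0 : ℂ) r, ‖(w - a i)⁻¹‖ₑ := by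
        rw [lintegral_finsetSum _ fun i _ => by fun_prop]
        refine Finset.sum_congr rfl fun i _ => ?_
        rw [lintegral_const_mul _ (by fun_prop)]
    _ < ∞ := ENNReal.sum_lt_top.2 fun i _ =>
        ENNReal.mul_lt_top enorm_lt_top (lintegral_ball_inv_sub_lt_top _ _)

/-- A fundamental domain for the action of the `d`-th roots of unity on `ℂ ∖ {0}`. -/
def rootSector (d : ℕ) : Set ℂ := {y | y ≠ 0 ∧ -(Real.pi / d) < y.arg ∧ y.arg ≤ Real.pi / d}

lemma measurableSet_rootSector (d : ℕ) : MeasurableSet (rootSector d) := by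
  refine (measurableSet_singleton (0 : ℂ)).compl.inter
    ((measurableSet_lt measurable_const Complex.measurable_arg).inter
      (measurableSet_le Complex.measurable_arg measurable_const))

lemma eq_of_pow_eq_of_mem_rootSector {d : ℕ} (hd : d ≠ 0) {y y' : ℂ} (hy : y ∈ rootSector d)
    (hy' : y' ∈ rootSector d) (h : y ^ d = y' ^ d) : y = y' := by
  rw [← Complex.pow_cpow_nat_inv hd hy.2.1 hy.2.2, h, Complex.pow_cpow_nat_inv hd hy'.2.1 hy'.2.2]

lemma exists_mem_rootSector_pow_eq {d : ℕ} (hd : d ≠ 0) {w : ℂ} (hw : w ≠ 0) :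
    ∃ y ∈ rootSector d, y ^ d = w := by
  have hd' : (0 : ℝ) < d := by positivity
  have h := Complex.cpow_nat_inv_pow w hd
  refine ⟨w ^ ((d : ℂ)⁻¹), ⟨fun h0 => hw ?_, ?_⟩, h⟩
  · rw [← h, h0, zero_pow hd]
  · have him : (Complex.log w * ((d : ℂ)⁻¹)).im = w.arg / d := by
      rw [show ((d : ℂ)⁻¹) = (((d : ℝ)⁻¹ : ℝ) : ℂ) by push_cast; rfl, Complex.im_mul_ofReal,
        Complex.log_im, div_eq_mul_inv]
    have h1 : -(Real.pi / d) < w.arg / d := by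
      rw [← neg_div]
      exact div_lt_div_of_pos_right (Complex.neg_pi_lt_arg w) hd'
    have h2 : w.arg / d ≤ Real.pi / d := div_le_div_of_nonneg_right (Complex.arg_le_pi w) hd'.le
    have hpd : Real.pi / d ≤ Real.pi :=
      div_le_self Real.pi_pos.le (by exact_mod_cast Nat.one_le_iff_ne_zero.2 hd)
    have harg : (w ^ ((d : ℂ)⁻¹)).arg = w.arg / d := by
      rw [Complex.cpow_def_of_ne_zero hw, Complex.arg_exp, him, toIocMod_eq_self]
      constructor <;> linarith
    rw [harg]
    exact ⟨h1, h2⟩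

lemma abs_det_restrictScalars_smulRight (a : ℂ) :
    |((ContinuousLinearMap.toSpanSingleton ℂ a).restrictScalars ℝ).det| = ‖a‖ ^ 2 := by
  rw [ContinuousLinearMap.det]
  have : ((ContinuousLinearMap.toSpanSingleton ℂ a).restrictScalars ℝ : ℂ →ₗ[ℝ] ℂ) =
      ((ContinuousLinearMap.toSpanSingleton ℂ a : ℂ →ₗ[ℂ] ℂ) : ℂ →ₗ[ℝ] ℂ) := rfl
  rw [this, LinearMap.det_restrictScalars, Algebra.norm_complex_apply, Complex.normSq_eq_norm_sq]
  simp

/-- The push-forward under `P(t) = t ^ d + c` does not increase the area of a quadratic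
differential: if `|q(P(y))|` is bounded by the push-forward of `|q|` at `P(y)`, then the area of `q`
on a disk is at most its area on the preimage of the disk. -/
lemma lintegral_ball_le_preimage {d : ℕ} (hd : 2 ≤ d) {ζ : ℂ} (hζ : IsPrimitiveRoot ζ d) (c : ℂ)
    {g : ℂ → ℝ≥0∞} (hg : Measurable g) {N : Set ℂ} (hN : N.Finite)
    (h : ∀ y ∉ N, ‖(d * y ^ (d - 1) : ℂ)‖ₑ ^ 2 * g (y ^ d + c) ≤
      ∑ j ∈ Finset.range d, g (ζ ^ j * y)) (R : ℝ) :
    ∫⁻ w in Metric.ball (0 : ℂ) R, g w ≤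
      ∫⁻ w in (fun t : ℂ => t ^ d + c) ⁻¹' Metric.ball (0 : ℂ) R, g w := by
  have hd0 : d ≠ 0 := by omega
  have hζ1 : ‖ζ‖ = 1 := Complex.norm_eq_one_of_pow_eq_one hζ.pow_eq_one hd0
  set f : ℂ → ℂ := fun t => t ^ d + c with hf
  have hfc : Continuous f := by fun_prop
  set B := f ⁻¹' Metric.ball (0 : ℂ) R with hB
  have hBm : MeasurableSet B := hfc.measurable measurableSet_ball
  set S := rootSector d ∩ B with hS
  have hSm : MeasurableSet S := (measurableSet_rootSector d).inter hBm
  have hinj : Set.InjOn f S := fun y hy y' hy' h =>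
    eq_of_pow_eq_of_mem_rootSector hd0 hy.1 hy'.1 (add_right_cancel h)
  have hder : ∀ y ∈ S, HasFDerivWithinAt f
      ((ContinuousLinearMap.toSpanSingleton ℂ (d * y ^ (d - 1) : ℂ)).restrictScalars ℝ) S y :=
    fun y _ => ((((hasDerivAt_pow d y).add_const c).hasFDerivAt).restrictScalars
      ℝ).hasFDerivWithinAt
  have himg : Metric.ball (0 : ℂ) R ⊆ f '' S ∪ {c} := by
    intro w hw
    rcases eq_or_ne w c with rfl | hwc
    · exact Or.inr rfl
    · obtain ⟨y, hy, hyw⟩ := exists_mem_rootSector_pow_eq hd0 (sub_ne_zero.2 hwc)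
      have hfy : f y = w := by rw [hf]; simp [hyw]
      exact Or.inl ⟨y, ⟨hy, by rw [hB, Set.mem_preimage, hfy]; exact hw⟩, hfy⟩
  have hzj : ∀ j, ‖ζ ^ j‖ = 1 := fun j => by rw [norm_pow, hζ1, one_pow]
  -- the rotations of the sector by the `d`-th roots of unity
  set T : ℕ → Set ℂ := fun j => (fun y => ζ ^ j * y) '' S with hT
  have hmp : ∀ j, MeasurePreserving (fun y : ℂ => ζ ^ j * y) volume volume := fun j =>
    (rotation ⟨ζ ^ j, mem_sphere_zero_iff_norm.2 (hzj j)⟩).measurePreserving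
  have hemb : ∀ j, MeasurableEmbedding (fun y : ℂ => ζ ^ j * y) := fun j =>
    (rotation ⟨ζ ^ j, mem_sphere_zero_iff_norm.2
      (hzj j)⟩).toHomeomorph.measurableEmbedding
  have hTm : ∀ j, MeasurableSet (T j) := fun j => (hemb j).measurableSet_image.2 hSm
  have hdisj : (Finset.range d : Set ℕ).PairwiseDisjoint T := by
    intro i hi j hj hij
    rw [Function.onFun, Set.disjoint_left]
    rintro _ ⟨y, hy, rfl⟩ ⟨y', hy', h'⟩
    simp only at h'
    have hpow : ∀ (n : ℕ) (t : ℂ), (ζ ^ n * t) ^ d = t ^ d := by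
      intro n t
      rw [mul_pow, ← pow_mul, mul_comm n, pow_mul, hζ.pow_eq_one, one_pow, one_mul]
    have hyy : y' = y := by
      refine eq_of_pow_eq_of_mem_rootSector hd0 hy'.1 hy.1 ?_
      rw [← hpow j y', h', hpow]
    rw [hyy] at h'
    exact hij (hζ.pow_inj (Finset.mem_range.1 hi) (Finset.mem_range.1 hj)
      (mul_right_cancel₀ hy.1.1 h').symm)
  calc ∫⁻ w in Metric.ball (0 : ℂ) R, g w
      ≤ ∫⁻ w in f '' S ∪ {c}, g w := lintegral_mono_set himg
    _ ≤ (∫⁻ w in f '' S, g w) + ∫⁻ w in {c}, g w := lintegral_union_le _ _ _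
    _ = ∫⁻ w in f '' S, g w := by
        rw [setLIntegral_measure_zero _ _ (measure_singleton c), add_zero]
    _ = ∫⁻ y in S, ‖(d * y ^ (d - 1) : ℂ)‖ₑ ^ 2 * g (f y) := by
        rw [lintegral_image_eq_lintegral_abs_det_fderiv_mul volume hSm hder hinj]
        refine lintegral_congr fun y => ?_
        rw [abs_det_restrictScalars_smulRight, ENNReal.ofReal_pow (norm_nonneg _),
          ofReal_norm]
    _ ≤ ∫⁻ y in S, ∑ j ∈ Finset.range d, g (ζ ^ j * y) := by
        refine lintegral_mono_ae (ae_restrict_of_ae ?_)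
        filter_upwards [hN.countable.ae_notMem volume] with y hy using h y hy
    _ = ∑ j ∈ Finset.range d, ∫⁻ y in S, g (ζ ^ j * y) :=
        lintegral_finsetSum _ fun j _ => hg.comp (measurable_const_mul _)
    _ = ∑ j ∈ Finset.range d, ∫⁻ w in T j, g w := by
        refine Finset.sum_congr rfl fun j _ => ?_
        exact ((hmp j).setLIntegral_comp_emb (hemb j) g S)
    _ = ∫⁻ w in ⋃ j ∈ Finset.range d, T j, g w :=
        (lintegral_biUnion_finset hdisj (fun j _ => hTm j) g).symm
    _ ≤ ∫⁻ w in B, g w := by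
        refine lintegral_mono_set (Set.iUnion₂_subset fun j _ => ?_)
        rintro _ ⟨y, hy, rfl⟩
        have : f (ζ ^ j * y) = f y := by
          simp only [hf]
          rw [mul_pow, ← pow_mul, mul_comm j, pow_mul, hζ.pow_eq_one, one_pow, one_mul]
        rw [hB, Set.mem_preimage, this]
        exact hy.2

lemma exists_preimage_ball_subset {d : ℕ} (hd : 2 ≤ d) (c : ℂ) :
    ∃ R : ℝ, 1 < R ∧
      (fun t : ℂ => t ^ d + c) ⁻¹' Metric.ball (0 : ℂ) R ⊆ Metric.ball (0 : ℂ) (R - 1) := by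
  refine ⟨4 + ‖c‖, by linarith [norm_nonneg c], fun t ht => ?_⟩
  rw [Set.mem_preimage, mem_ball_zero_iff] at ht
  rw [mem_ball_zero_iff]
  by_contra! hlt
  have hc := norm_nonneg c
  have h1 : ‖t‖ ^ d ≤ ‖t ^ d + c‖ + ‖c‖ := by
    rw [← norm_pow]
    simpa using norm_sub_le (t ^ d + c) c
  have h2 : ‖t‖ ^ 2 ≤ ‖t‖ ^ d := pow_le_pow_right₀ (by linarith) hd
  nlinarith

/-- A rational quadratic differential `q = ∑ ρ_i / (t - a_i) dt²` with `q = λ P_* q`, where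
`|λ| ≤ 1`, has infinitely many zeros: on a large disk the area of `q` is at most its area on the
preimage of the disk, which lies in a smaller concentric disk, so `q` vanishes in between. -/
lemma infinite_zeros_of_pushforward_eq {d : ℕ} (hd : 2 ≤ d) {ζ : ℂ} (hζ : IsPrimitiveRoot ζ d)
    (c : ℂ) {ι : Type*} (s : Finset ι) (ρ a : ι → ℂ) {lam : ℂ} (hlam : ‖lam‖ ≤ 1) {N : Set ℂ}
    (hN : N.Finite) {q : ℂ → ℂ} (hq : ∀ w, q w = ∑ i ∈ s, ρ i * (w - a i)⁻¹)
    (h : ∀ y ∉ N, q (y ^ d + c) =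
      lam * ∑ j ∈ Finset.range d, q (ζ ^ j * y) / (d * (ζ ^ j * y) ^ (d - 1)) ^ 2) :
    {w | q w = 0}.Infinite := by
  have hd0 : d ≠ 0 := by omega
  have hζ1 : ‖ζ‖ = 1 := Complex.norm_eq_one_of_pow_eq_one hζ.pow_eq_one hd0
  have hqm : Measurable q := by
    rw [show q = _ from funext hq]
    fun_prop
  obtain ⟨R, hR1, hR⟩ := exists_preimage_ball_subset hd c
  have hle : ∫⁻ w in Metric.ball (0 : ℂ) R, ‖q w‖ₑ ≤
      ∫⁻ w in Metric.ball (0 : ℂ) (R - 1), ‖q w‖ₑ := by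
    refine (lintegral_ball_le_preimage hd hζ c hqm.enorm (hN.union (Set.finite_singleton 0)) ?_
      R).trans (lintegral_mono_set hR)
    intro y hy
    rw [Set.mem_union, not_or] at hy
    have hy0 : y ≠ 0 := hy.2
    have hne : ‖(d * y ^ (d - 1) : ℂ)‖ₑ ^ 2 ≠ 0 := by
      simp [hd0, hy0]
    have hnt : ‖(d * y ^ (d - 1) : ℂ)‖ₑ ^ 2 ≠ ∞ := ENNReal.pow_ne_top enorm_ne_top
    have hterm : ∀ j, ‖q (ζ ^ j * y) / (d * (ζ ^ j * y) ^ (d - 1)) ^ 2‖ₑ =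
        ‖q (ζ ^ j * y)‖ₑ * (‖(d * y ^ (d - 1) : ℂ)‖ₑ ^ 2)⁻¹ := by
      intro j
      have hn : ‖((d * (ζ ^ j * y) ^ (d - 1)) ^ 2 : ℂ)‖ = ‖((d * y ^ (d - 1)) ^ 2 : ℂ)‖ := by
        simp [hζ1]
      have hz : ((d * (ζ ^ j * y) ^ (d - 1)) ^ 2 : ℂ) ≠ 0 := by
        rw [← norm_ne_zero_iff, hn]
        simp [hd0, hy0]
      rw [div_eq_mul_inv, enorm_mul, enorm_inv hz, ← ofReal_norm ((_ : ℂ) ^ 2), hn, ofReal_norm,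
        enorm_pow]
    have hlam' : ‖lam‖ₑ ≤ 1 := by
      rw [← ofReal_norm]
      exact ENNReal.ofReal_le_one.2 hlam
    calc ‖(d * y ^ (d - 1) : ℂ)‖ₑ ^ 2 * ‖q (y ^ d + c)‖ₑ
        ≤ ‖(d * y ^ (d - 1) : ℂ)‖ₑ ^ 2 *
          (∑ j ∈ Finset.range d, ‖q (ζ ^ j * y)‖ₑ * (‖(d * y ^ (d - 1) : ℂ)‖ₑ ^ 2)⁻¹) := by
          gcongr
          rw [h y hy.1, enorm_mul]
          refine (mul_le_of_le_one_left zero_le hlam').trans ((enorm_sum_le _ _).trans ?_)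
          exact Finset.sum_le_sum fun j _ => (hterm j).le
      _ = ∑ j ∈ Finset.range d, ‖q (ζ ^ j * y)‖ₑ := by
          rw [← Finset.sum_mul, mul_left_comm, ENNReal.mul_inv_cancel hne hnt, mul_one]
  -- hence `q` vanishes almost everywhere on the annulus between the two disks
  set A := Metric.ball (0 : ℂ) R \ Metric.ball (0 : ℂ) (R - 1) with hA
  have hAm : MeasurableSet A := measurableSet_ball.diff measurableSet_ball
  have hfin : ∫⁻ w in Metric.ball (0 : ℂ) (R - 1), ‖q w‖ₑ ≠ ∞ := by
    simp_rw [hq]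
    exact (lintegral_ball_sum_lt_top s ρ a _).ne
  have hzero : ∫⁻ w in A, ‖q w‖ₑ = 0 := by
    have hsub : Metric.ball (0 : ℂ) (R - 1) ⊆ Metric.ball (0 : ℂ) R :=
      Metric.ball_subset_ball (by linarith)
    have hsplit := lintegral_inter_add_sdiff (μ := volume) (fun w => ‖q w‖ₑ) (Metric.ball (0 : ℂ) R)
      (measurableSet_ball (x := (0 : ℂ)) (ε := R - 1))
    rw [Set.inter_eq_self_of_subset_right hsub] at hsplit
    rw [← hsplit] at hle
    by_contra hne
    exact absurd hle (not_le.2 (ENNReal.lt_add_right hfin hne))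
  rw [setLIntegral_eq_zero_iff hAm hqm.enorm] at hzero
  intro hcon
  have hvol : volume A = 0 := by
    have hcount := hcon.countable.ae_notMem (μ := (volume : Measure ℂ))
    rw [measure_eq_zero_iff_ae_notMem]
    filter_upwards [hzero, hcount] with w h1 h2 h3
    exact h2 (enorm_eq_zero.1 (h1 h3))
  have hopen : Metric.ball ((R - 1 / 2 : ℝ) : ℂ) (1 / 2) ⊆ A := by
    intro w hw
    rw [Metric.mem_ball, dist_eq_norm] at hw
    have hn : ‖((R - 1 / 2 : ℝ) : ℂ)‖ = R - 1 / 2 := by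
      rw [Complex.norm_real, Real.norm_of_nonneg (by linarith)]
    have h1 := norm_sub_norm_le w ((R - 1 / 2 : ℝ) : ℂ)
    have h2 := norm_sub_norm_le ((R - 1 / 2 : ℝ) : ℂ) w
    rw [norm_sub_rev] at h2
    rw [hn] at h1 h2
    refine ⟨mem_ball_zero_iff.2 (by linarith), fun h3 => ?_⟩
    rw [mem_ball_zero_iff] at h3
    linarith
  exact (Metric.measure_ball_pos volume ((R - 1 / 2 : ℝ) : ℂ) (by norm_num : (0 : ℝ) < 1 / 2)).ne'
    (measure_mono_null hopen hvol)

/-- Simple fractions with distinct poles are linearly independent, even on any infinite set. -/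
lemma eq_zero_of_infinite_zeros {ι : Type*} [DecidableEq ι] (s : Finset ι) (ρ a : ι → ℂ)
    (ha : Set.InjOn a s) (h : {w | ∑ i ∈ s, ρ i * (w - a i)⁻¹ = 0}.Infinite) :
    ∀ i ∈ s, ρ i = 0 := by
  set p : ℂ[X] := ∑ i ∈ s, C (ρ i) * ∏ j ∈ s.erase i, (X - C (a j)) with hp
  have hp0 : p = 0 := by
    refine Polynomial.eq_zero_of_infinite_isRoot p
      ((h.sdiff (s.image a).finite_toSet).mono ?_)
    rintro w ⟨hw, hwa⟩
    have hne : ∀ i ∈ s, w - a i ≠ 0 := fun i hi h0 =>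
      hwa (Finset.mem_coe.2 (Finset.mem_image.2 ⟨i, hi, (sub_eq_zero.1 h0).symm⟩))
    have : p.eval w = (∏ j ∈ s, (w - a j)) * ∑ i ∈ s, ρ i * (w - a i)⁻¹ := by
      rw [hp, eval_finsetSum, Finset.mul_sum]
      refine Finset.sum_congr rfl fun i hi => ?_
      rw [← Finset.mul_prod_erase s _ hi]
      simp only [eval_mul, eval_C, eval_prod, eval_sub, eval_X]
      field_simp [hne i hi]
    change p.eval w = 0
    rw [this, show ∑ i ∈ s, ρ i * (w - a i)⁻¹ = 0 from hw, mul_zero]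
  intro i hi
  have hev : p.eval (a i) = ρ i * ∏ j ∈ s.erase i, (a i - a j) := by
    rw [hp, eval_finsetSum, Finset.sum_eq_single_of_mem i hi]
    · simp [eval_prod]
    · intro j hj hji
      rw [eval_mul, eval_prod, Finset.prod_eq_zero (Finset.mem_erase.2 ⟨hji.symm, hi⟩), mul_zero]
      simp
  rw [hp0, eval_zero] at hev
  refine (mul_eq_zero.1 hev.symm).resolve_right (Finset.prod_ne_zero_iff.2 fun j hj h0 => ?_)
  obtain ⟨hji, hj⟩ := Finset.mem_erase.1 hj
  exact hji (ha hj hi (sub_eq_zero.1 h0).symm)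

end

noncomputable section

/-! ### Fixed points of `F_{k,m}` as postcritical orbits -/

section FixedPoint

variable {d : ℕ} {β : ℂ} {k : ℕ} {m : ℕ+}

lemma kochTerm_succ_of_fixed (hd : 2 ≤ d) (hβ : β ^ d = 1) (hβ1 : β ≠ 1) {z : kochM β k m}
    (hz : kochF hd hβ hβ1 k m z = z) (i : ℕ) :
    kochTerm z (i + 1) = kochTerm z i ^ d + z.1 1 := by
  have h : ∀ i, kochTerm z (i + 1) = kochTerm z i ^ d - kochShift β k m (kochQ d z) := by
    intro i
    conv_lhs => rw [← hz]
    change kochTerm (kochProj β k m (kochQ d z)) (i + 1) = _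
    rw [kochTerm_proj _ _ _ _ (Nat.succ_pos i), kochTerm_kochQ hd]
  have h0 := h 0
  rw [kochTerm_zero, zero_pow (by omega), zero_sub, zero_add] at h0
  rw [h i, sub_eq_add_neg, ← h0]
  rfl

variable {c : ℂ} {z : KochSeq}

/-- In an orbit, a type is detected by a single coincidence. -/
lemma kochHasType_of_eq (hz : ∀ i, kochTerm z (i + 1) = kochTerm z i ^ d + c) {a b : ℕ}
    (h : kochTerm z (a + 1 + b) = kochTerm z (a + 1)) : KochHasType z a b := by
  intro i hi
  induction i, hi using Nat.le_induction with
  | base => exact h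
  | succ i _ ih => rw [show i + 1 + b = i + b + 1 by ring, hz, hz, ih]

lemma iterate_eval_eq_kochTerm (hz : ∀ i, kochTerm z (i + 1) = kochTerm z i ^ d + c)
    (i j : ℕ) :
    (fun t => (X ^ d + C c : ℂ[X]).eval t)^[i] (kochTerm z j) = kochTerm z (j + i) := by
  induction i with
  | zero => rfl
  | succ i ih =>
    rw [Function.iterate_succ_apply', ih, ← add_assoc, hz]
    simp

lemma eval_derivative_X_pow_add_C (d : ℕ) (c t : ℂ) :
    (derivative (X ^ d + C c : ℂ[X])).eval t = d * t ^ (d - 1) := by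
  rw [derivative_add, derivative_C, add_zero, derivative_X_pow]
  simp

lemma isPreperiodicPoint_of_exactType
    (hz : ∀ i, kochTerm z (i + 1) = kochTerm z i ^ d + c) (hT : KochHasExactType z k m) :
    IsPreperiodicPoint (fun t => (X ^ d + C c : ℂ[X]).eval t) (kochTerm z 1) k m := by
  refine ⟨hT.1, ?_, fun a b hb h => hT.2.2 a b hb (kochHasType_of_eq hz ?_)⟩
  · rw [iterate_eval_eq_kochTerm hz, iterate_eval_eq_kochTerm hz, ← hT.2.1 (1 + k) (by omega)]
    congr 1
    ring
  · rw [iterate_eval_eq_kochTerm hz, iterate_eval_eq_kochTerm hz] at h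
    rw [add_comm a, ← h]
    congr 1
    ring

lemma postCriticallyFinite_of_type (hd : 2 ≤ d)
    (hz : ∀ i, kochTerm z (i + 1) = kochTerm z i ^ d + c) {a b : ℕ} (hb : 0 < b)
    (hT : KochHasType z a b) : PostCriticallyFinite (X ^ d + C c : ℂ[X]) := by
  refine ((Finset.range (a + b + 1)).image (kochTerm z)).finite_toSet.subset ?_
  intro w hw
  simp only [Set.mem_iUnion] at hw
  obtain ⟨j, -, t, ht, rfl⟩ := hw
  have ht0 : t = kochTerm z 0 := by
    rw [kochTerm_zero]
    have : (d : ℂ) * t ^ (d - 1) = 0 := (eval_derivative_X_pow_add_C d c t).symm.trans ht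
    exact pow_eq_zero_iff (by omega) |>.1
      ((mul_eq_zero.1 this).resolve_left (Nat.cast_ne_zero.2 (by omega)))
  simp only [ht0, iterate_eval_eq_kochTerm hz, zero_add, Finset.coe_image, Set.mem_image,
    Finset.coe_range, Set.mem_Iio]
  exact ⟨kochIndex a b j, Nat.lt_succ_of_le (kochIndex_le a hb j), hT.kochTerm_kochIndex j⟩

/-- If the preperiod is smaller than `k`, then `z_k = z_{k+m}` and `z_k = β z_{k+m}`, so `z_k` is the
critical point `0` and the orbit is periodic with period dividing `k`. -/
lemma kochLE_of_exactType (hβ1 : β ≠ 1)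
    (hz : ∀ i, kochTerm z (i + 1) = kochTerm z i ^ d + c) (hzM : z ∈ kochM β k m) {k' : ℕ}
    {m' : ℕ+} (hT : KochHasExactType z k' m') : KochLE (k', m') (k, m) := by
  obtain ⟨hT', hH⟩ := mem_kochM_iff.1 hzM
  obtain ⟨hk, hm⟩ := hT.le_and_dvd m.pos hT'
  refine ⟨hm, ?_⟩
  rcases hk.eq_or_lt with h | h
  · exact Or.inl h
  · have hper : kochTerm z (k + m) = kochTerm z k :=
      (hT.2.1.of_dvd hm) k (by omega)
    have h0 : kochTerm z k = 0 := by
      have : (β - 1) * kochTerm z k = 0 := by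
        rw [hper] at hH
        linear_combination hH
      exact (mul_eq_zero.1 this).resolve_left (sub_ne_zero.2 hβ1)
    have h1 : KochHasType z 0 k := by
      refine kochHasType_of_eq hz ?_
      rw [show 0 + 1 + k = k + 1 by ring, hz k, hz 0, h0, kochTerm_zero]
    obtain ⟨h2, h3⟩ := hT.le_and_dvd (by omega) h1
    exact Or.inr ⟨by simpa using h2, h3⟩

lemma kochTerm_injOn_of_exactType (hz : ∀ i, kochTerm z (i + 1) = kochTerm z i ^ d + c)
    (hT : KochHasExactType z k m) : Set.InjOn (kochTerm z) (Finset.Icc 1 (k + m : ℕ)) := by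
  have key : ∀ i j, 1 ≤ i → i < j → j ≤ k + m → kochTerm z j ≠ kochTerm z i := by
    intro i j hi hij hj h
    have h1 : KochHasType z (i - 1) (j - i) := by
      refine kochHasType_of_eq hz ?_
      rw [Nat.sub_add_cancel hi, Nat.add_sub_cancel' hij.le, h]
    have := hT.2.2 _ _ (by omega) h1
    omega
  intro i hi j hj h
  rw [Finset.coe_Icc, Set.mem_Icc] at hi hj
  rcases lt_trichotomy i j with hij | hij | hij
  · exact absurd h.symm (key i j hi.1 hij hj.2)
  · exact hij
  · exact absurd h (key j i hj.1 hij hi.2)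

/-- The critical point `0` lies on the orbit of the critical value only in the periodic case, at the
multiples of the period. -/
lemma dvd_of_kochTerm_eq_zero (hz : ∀ i, kochTerm z (i + 1) = kochTerm z i ^ d + c)
    (hT : KochHasExactType z k m) {i : ℕ} (hi : 0 < i) (h : kochTerm z i = 0) :
    k = 0 ∧ (m : ℕ) ∣ i := by
  have h1 : KochHasType z 0 i := by
    refine kochHasType_of_eq hz ?_
    rw [show 0 + 1 + i = i + 1 by ring, hz i, hz 0, h, kochTerm_zero]
  obtain ⟨h2, h3⟩ := hT.le_and_dvd hi h1
  exact ⟨by omega, h3⟩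

lemma cycleMultiplier_eq_prod (hz : ∀ i, kochTerm z (i + 1) = kochTerm z i ^ d + c)
    (j n : ℕ) :
    cycleMultiplier (X ^ d + C c) (kochTerm z j) n =
      ∏ i ∈ Finset.range n, (d * kochTerm z (j + i) ^ (d - 1) : ℂ) := by
  suffices h : HasDerivAt ((fun t => (X ^ d + C c : ℂ[X]).eval t)^[n])
      (∏ i ∈ Finset.range n, (d * kochTerm z (j + i) ^ (d - 1) : ℂ)) (kochTerm z j) from h.deriv
  induction n with
  | zero => simpa using hasDerivAt_id (kochTerm z j)
  | succ n ih =>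
    rw [Function.iterate_succ', Finset.prod_range_succ, mul_comm]
    refine HasDerivAt.comp _ ?_ ih
    rw [iterate_eval_eq_kochTerm hz]
    rw [← eval_derivative_X_pow_add_C d c]
    exact (X ^ d + C c : ℂ[X]).hasDerivAt (kochTerm z (j + n))

end FixedPoint

/-! ### Eigenvalues along `M_{k',m'}` -/

lemma exists_left_eigenvector {V : Type*} [AddCommGroup V] [Module ℂ V] [FiniteDimensional ℂ V]
    {A : Module.End ℂ V} {μ : ℂ} (h : μ ∈ spectrum ℂ A) :
    ∃ ω : Module.Dual ℂ V, ω ≠ 0 ∧ ∀ v, ω (A v) = μ * ω v := by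
  rw [spectrum.mem_iff] at h
  have hsurj : LinearMap.range (algebraMap ℂ (Module.End ℂ V) μ - A) ≠ ⊤ := by
    intro htop
    refine h ((Module.End.isUnit_iff _).2 ⟨?_, LinearMap.range_eq_top.1 htop⟩)
    exact LinearMap.injective_iff_surjective.2 (LinearMap.range_eq_top.1 htop)
  obtain ⟨ω, hω, hle⟩ := Submodule.exists_le_ker_of_lt_top _ (lt_top_iff_ne_top.2 hsurj)
  refine ⟨ω, hω, fun v => ?_⟩
  have := hle ⟨v, rfl⟩
  rw [LinearMap.mem_ker] at this
  have h2 : μ * ω v - ω (A v) = 0 := by simpa using this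
  linear_combination -h2

lemma kochProj_eq_of_sub_const {β : ℂ} (hβ1 : β ≠ 1) (k : ℕ) (m : ℕ+) (x y : KochSeq) (a : ℂ)
    (h : ∀ i, x i = y i - a) : kochProj β k m x = kochProj β k m y := by
  have hs : kochShift β k m x = kochShift β k m y - a := by
    have ht : ∀ i, 0 < i → kochTerm x i = kochTerm y i - a := fun i hi => by
      rw [kochTerm_of_pos _ hi, kochTerm_of_pos _ hi, h]
    have hm := m.pos
    unfold kochShift
    split_ifs with hk
    · exact ht _ hm
    · have := sub_ne_zero.2 hβ1
      rw [ht _ (by omega), ht _ (by omega)]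
      field_simp
      ring
  funext i
  simp [kochProj, hs, h]

lemma kochProj_eq_self {β : ℂ} (hβ0 : β ≠ 0) {k : ℕ} {m : ℕ+} {x : KochSeq}
    (hx : x ∈ kochM β k m) : kochProj β k m x = x := by
  have hH := (mem_kochM_iff.1 hx).2
  have hs : kochShift β k m x = 0 := by
    unfold kochShift
    split_ifs with hk
    · subst hk
      exact kochTerm_eq_zero_of_dvd hβ0 hx dvd_rfl
    · rw [hH, sub_self, zero_div]
  funext i
  simp [kochProj, hs]

/-- The projection of the preperiodic sequences of type `(k, m)` onto `M_{k,m}`. -/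
def kochPM {β : ℂ} (hβ1 : β ≠ 1) (k : ℕ) (m : ℕ+) : kochP k m →ₗ[ℂ] kochM β k m :=
  ((kochProjL β k m : KochSeq →ₗ[ℂ] KochSeq).domRestrict (kochP k m)).codRestrict (kochM β k m)
    fun x => by
      change kochProjL β k m x ∈ kochM β k m
      rw [kochProjL_apply]
      exact kochProj_mem_kochM hβ1 x.2

lemma coe_kochPM {β : ℂ} (hβ1 : β ≠ 1) (k : ℕ) (m : ℕ+) (x : kochP k m) :
    (kochPM hβ1 k m x : KochSeq) = kochProj β k m x :=
  kochProjL_apply β k m x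

/-- The sequence of type `(k, m)` whose first `k + m` terms vanish, except the `i`-th one, which
is `1`. -/
def kochSingle (k : ℕ) (m : ℕ+) (i : ℕ) : kochP k m :=
  ⟨kochOf fun j => if kochIndex k m j = i then 1 else 0,
    kochHasType_kochOf_kochIndex k m fun j => if j = i then 1 else 0⟩

lemma kochTerm_kochSingle (k : ℕ) (m : ℕ+) (i : ℕ) {j : ℕ} (hj : 0 < j) :
    kochTerm (kochSingle k m i) j = if kochIndex k m j = i then 1 else 0 :=
  kochTerm_of (fun j => if kochIndex k m j = i then 1 else 0) hj

lemma kochTerm_sum {ι : Type*} (s : Finset ι) (x : ι → KochSeq) (i : ℕ) :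
    kochTerm (∑ j ∈ s, x j) i = ∑ j ∈ s, kochTerm (x j) i := by
  simp_rw [← kochTermL_apply]
  exact map_sum _ _ _

lemma kochP_eq_sum (k : ℕ) (m : ℕ+) (x : kochP k m) :
    x = ∑ i ∈ Finset.Icc 1 (k + m : ℕ), kochTerm x i • kochSingle k m i := by
  refine Subtype.ext (kochSeq_ext fun j hj => ?_)
  have hT : KochHasType x k m := x.2
  rw [Submodule.coe_sum, kochTerm_sum, Finset.sum_eq_single_of_mem (kochIndex k m j)]
  · rw [Submodule.coe_smul, kochTerm_smul, kochTerm_kochSingle _ _ _ hj, if_pos rfl, mul_one,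
      hT.kochTerm_kochIndex]
  · exact Finset.mem_Icc.2 ⟨kochIndex_pos k m hj, kochIndex_le k m.pos j⟩
  · intro i _ hi
    rw [Submodule.coe_smul, kochTerm_smul, kochTerm_kochSingle _ _ _ hj, if_neg hi.symm, mul_zero]

lemma linearMap_kochP_eq_sum (k : ℕ) (m : ℕ+) (Φ : kochP k m →ₗ[ℂ] ℂ) (x : kochP k m) :
    Φ x = ∑ i ∈ Finset.Icc 1 (k + m : ℕ), Φ (kochSingle k m i) * kochTerm x i := by
  conv_lhs => rw [kochP_eq_sum k m x]
  rw [map_sum]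
  exact Finset.sum_congr rfl fun i _ => by rw [map_smul, smul_eq_mul, mul_comm]

/-- A left eigenvector `ω` of `D_zF_{k,m}` defines the quadratic differential
`q(w) = ω(π(1/(w - z_i))_i)`. As the pushforward under `P(t) = t ^ d + z_1` is dual to the inverse
of the derivative, `q = λ P_* q`. When `|λ| ≤ 1` this forces `q = 0`, hence `ω = 0`. -/
lemma spectrum_kochD_subset {d : ℕ} (hd : 2 ≤ d) {β : ℂ} (hβ : β ^ d = 1) (hβ1 : β ≠ 1) {k : ℕ}
    {m : ℕ+} (z : kochM β k m) {c : ℂ} (hz : ∀ i, kochTerm z (i + 1) = kochTerm z i ^ d + c)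
    (hT : KochHasExactType z k m) :
    spectrum ℂ (kochD hd hβ hβ1 k m z) ⊆ (Metric.closedBall (0 : ℂ) 1)ᶜ := by
  have hβ0 := beta_ne_zero hd hβ
  have := finiteDimensional_kochM hβ0 hβ1 k m
  have hd0 : (d : ℂ) ≠ 0 := Nat.cast_ne_zero.2 (by omega)
  intro lam hlam hball
  rw [mem_closedBall_zero_iff] at hball
  obtain ⟨ω, hω0, hω⟩ := exists_left_eigenvector hlam
  set ζ : ℂ := Complex.exp (2 * Real.pi * Complex.I / d)
  have hζ : IsPrimitiveRoot ζ d := Complex.isPrimitiveRoot_exp d (by omega)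
  have hzT : KochHasType z k m := hT.2.1
  -- the sequence of simple fractions with poles along the orbit
  let U : ℂ → kochP k m := fun w => ⟨kochOf fun i => (w - kochTerm z i)⁻¹, by
    intro i hi
    rw [kochTerm_of _ (by omega), kochTerm_of _ (by omega), hzT i hi]⟩
  have hU : ∀ w i, 0 < i → kochTerm (U w) i = (w - kochTerm z i)⁻¹ := fun w i hi =>
    kochTerm_of (fun i => (w - kochTerm z i)⁻¹) hi
  have hc : kochTerm z 1 = c := by
    have := hz 0
    rwa [kochTerm_zero, zero_pow (by omega), zero_add, zero_add] at this
  -- the solution in `M_{k,m}` of `D_zF Y = π U`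
  let Y : ℂ → KochSeq := fun w => kochOf fun i =>
    ((w - kochTerm z (i + 1))⁻¹ - (w - c)⁻¹) / (d * kochTerm z i ^ (d - 1))
  have hY : ∀ w i, 0 < i → kochTerm (Y w) i =
      ((w - kochTerm z (i + 1))⁻¹ - (w - c)⁻¹) / (d * kochTerm z i ^ (d - 1)) :=
    fun w i hi => kochTerm_of (fun i =>
      ((w - kochTerm z (i + 1))⁻¹ - (w - c)⁻¹) / (d * kochTerm z i ^ (d - 1))) hi
  have hYM : ∀ w, Y w ∈ kochM β k m := by
    intro w
    have hm := m.pos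
    refine mem_kochM_iff.2 ⟨?_, ?_⟩
    · intro i hi
      rw [hY _ _ (by omega), hY _ _ (by omega), hzT i hi, show i + (m : ℕ) + 1 = i + 1 + m by ring,
        hzT (i + 1) (by omega)]
    · rw [hY _ _ (by omega), pow_pred_eq_of_mem_kochM hd hβ z.2,
        show k + (m : ℕ) + 1 = k + 1 + m by ring, hzT (k + 1) le_rfl]
      rcases Nat.eq_zero_or_pos k with h0 | hk
      · subst h0
        simp [kochTerm_zero, show d - 1 ≠ 0 by omega]
      · rw [hY _ _ hk]
        field_simp
  have hAY : ∀ w, kochD hd hβ hβ1 k m z ⟨Y w, hYM w⟩ = kochPM hβ1 k m (U w) := by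
    intro w
    refine Subtype.ext ?_
    rw [coe_kochD_apply, coe_kochPM]
    refine kochProj_eq_of_sub_const hβ1 k m _ _ (w - c)⁻¹ fun i => ?_
    rw [← kochTerm_coe (kochDQ d z _) i, ← kochTerm_coe (U w).1 i, hU _ _ i.pos]
    obtain ⟨j, hj⟩ : ∃ j, (i : ℕ) = j + 1 := ⟨i - 1, (Nat.sub_add_cancel i.pos).symm⟩
    rw [hj, kochTerm_kochDQ]
    rcases eq_or_ne (kochTerm z j) 0 with h0 | h0
    · rw [hz j, h0, zero_pow (by omega), zero_pow (by omega)]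
      simp
    · have hj0 : 0 < j := Nat.pos_of_ne_zero fun h => h0 (h ▸ kochTerm_zero _)
      change _ * kochTerm (Y w) j = _
      rw [hY _ _ hj0]
      exact mul_div_cancel₀ _ (mul_ne_zero hd0 (pow_ne_zero _ h0))
  let Φ : kochP k m →ₗ[ℂ] ℂ := ω ∘ₗ kochPM hβ1 k m
  set q : ℂ → ℂ := fun w => Φ (U w) with hqdef
  have hq : ∀ w, q w = ∑ i ∈ Finset.Icc 1 (k + m : ℕ),
      Φ (kochSingle k m i) * (w - kochTerm z i)⁻¹ := by
    intro w
    rw [hqdef]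
    simp only
    rw [linearMap_kochP_eq_sum]
    refine Finset.sum_congr rfl fun i hi => ?_
    rw [hU _ _ (Finset.mem_Icc.1 hi).1]
  -- the pushforward of the fractions is `Y`, so the pushforward of `q` is `ω(Y)`
  have hpush : ∀ y ∉ ({0} ∪ ⋃ i ∈ Finset.Icc 1 (k + m : ℕ),
      {y : ℂ | y ^ d = kochTerm z i ^ d} : Set ℂ),
      q (y ^ d + c) =
        lam * ∑ j ∈ Finset.range d, q (ζ ^ j * y) / (d * (ζ ^ j * y) ^ (d - 1)) ^ 2 := by
    intro y hy
    simp only [Set.mem_union, Set.mem_singleton_iff, Set.mem_iUnion, Set.mem_ofPred_eq, not_or,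
      not_exists] at hy
    have hYP : kochPM hβ1 k m ⟨Y (y ^ d + c), (hYM _).1⟩ = ⟨Y (y ^ d + c), hYM _⟩ :=
      Subtype.ext ((coe_kochPM _ _ _ _).trans (kochProj_eq_self hβ0 (hYM _)))
    have h1 : q (y ^ d + c) = lam * Φ ⟨Y (y ^ d + c), (hYM _).1⟩ := by
      change ω (kochPM hβ1 k m (U (y ^ d + c))) = lam * ω (kochPM hβ1 k m _)
      rw [hYP, ← hAY, hω]
    rw [h1, linearMap_kochP_eq_sum]
    congr 1
    simp_rw [hq, Finset.sum_div]
    rw [Finset.sum_comm]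
    refine Finset.sum_congr rfl fun i hi => ?_
    simp_rw [mul_div_assoc]
    rw [← Finset.mul_sum, sum_pushforward_inv_sub hd hζ hy.1 (hy.2 i hi) c]
    rw [hY _ _ (Finset.mem_Icc.1 hi).1, hz i]
  have hfin : ({0} ∪ ⋃ i ∈ Finset.Icc 1 (k + m : ℕ),
      {y : ℂ | y ^ d = kochTerm z i ^ d} : Set ℂ).Finite := by
    refine (Set.finite_singleton 0).union (Set.Finite.biUnion (Finset.finite_toSet _) fun i _ => ?_)
    refine ((nthRoots d (kochTerm z i ^ d)).toFinset.finite_toSet).subset fun y hy => ?_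
    rw [Finset.mem_coe, Multiset.mem_toFinset, mem_nthRoots (by omega)]
    exact hy
  have hinf := infinite_zeros_of_pushforward_eq hd hζ c _ _ _ hball hfin hq hpush
  simp_rw [hq] at hinf
  have hρ := eq_zero_of_infinite_zeros _ _ _ (kochTerm_injOn_of_exactType hz hT) hinf
  refine hω0 (LinearMap.ext fun v => ?_)
  have hv : kochPM hβ1 k m ⟨v, v.2.1⟩ = v :=
    Subtype.ext ((coe_kochPM _ _ _ _).trans (kochProj_eq_self hβ0 v.2))
  have : Φ ⟨v, v.2.1⟩ = 0 := by
    rw [linearMap_kochP_eq_sum]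
    exact Finset.sum_eq_zero fun i hi => by rw [hρ i hi, zero_mul]
  rw [← hv]
  exact this

end

noncomputable section

/-! ### Eigenvalues transverse to `M_{k',m'}` -/

lemma mem_kochAnn_iff {β : ℂ} {k k' : ℕ} {m m' : ℕ+} {ω : Module.Dual ℂ (kochM β k m)} :
    ω ∈ kochAnn β k m k' m' ↔ ∀ v : kochM β k m, (v : KochSeq) ∈ kochM β k' m' → ω v = 0 := by
  rw [kochAnn, Submodule.mem_dualAnnihilator]
  exact Iff.rfl

lemma mem_spectrum_dualMap_restrict_iff {V : Type*} [AddCommGroup V] [Module ℂ V]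
    [FiniteDimensional ℂ V] {A : Module.End ℂ V} {W : Submodule ℂ (Module.Dual ℂ V)}
    (hinv : ∀ ω ∈ W, A.dualMap ω ∈ W) {μ : ℂ} :
    μ ∈ spectrum ℂ (A.dualMap.restrict hinv : Module.End ℂ W) ↔
      ∃ ω ∈ W, ω ≠ 0 ∧ ∀ v, ω (A v) = μ * ω v := by
  rw [← Module.End.hasEigenvalue_iff_mem_spectrum]
  constructor
  · intro h
    obtain ⟨ω, hω⟩ := h.exists_hasEigenvector
    refine ⟨ω, ω.2, fun h0 => hω.2 (Subtype.ext h0), fun v => ?_⟩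
    have := congrArg (fun η : W => (η : Module.Dual ℂ V) v) hω.apply_eq_smul
    simpa using this
  · rintro ⟨ω, hωW, hω0, hω⟩
    refine Module.End.hasEigenvalue_of_hasEigenvector (x := ⟨ω, hωW⟩)
      ⟨Module.End.mem_eigenspace_iff.2 ?_, fun h0 => hω0 (congrArg Subtype.val h0)⟩
    exact Subtype.ext (LinearMap.ext fun v => by simpa using hω v)

section Transverse

variable {d : ℕ} (hd : 2 ≤ d) {β : ℂ} (hβ : β ^ d = 1) (hβ1 : β ≠ 1) {k : ℕ} {m : ℕ+}

lemma kochD_mem {k' : ℕ} {m' : ℕ+} (hle : KochLE (k', m') (k, m)) {z v : kochM β k m}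
    (hz : (z : KochSeq) ∈ kochM β k' m') (hv : (v : KochSeq) ∈ kochM β k' m') :
    (kochD hd hβ hβ1 k m z v : KochSeq) ∈ kochM β k' m' := by
  have hT := kochHasType_kochDQ hd hβ hz hv
  rw [coe_kochD_apply, kochProj_eq_of_kochLE hβ1 hle hT]
  exact kochProj_mem_kochM hβ1 hT

lemma kochD_dualMap_mem_kochAnn {k' : ℕ} {m' : ℕ+} (hle : KochLE (k', m') (k, m)) {z : kochM β k m}
    (hz : (z : KochSeq) ∈ kochM β k' m') :
    ∀ ω ∈ kochAnn β k m k' m', (kochD hd hβ hβ1 k m z).dualMap ω ∈ kochAnn β k m k' m' := by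
  intro ω hω
  rw [mem_kochAnn_iff] at hω ⊢
  exact fun v hv => hω _ (kochD_mem hd hβ hβ1 hle hz hv)

/-- Modulo sequences of period `m'`, the derivative is a weighted shift. -/
lemma kochTerm_kochD_pow_sub {m' K : ℕ} {z : kochM β k m}
    (hK : ∀ i, K ≤ i → kochTerm z (i + m') = kochTerm z i) (n : ℕ) (v : kochM β k m) {i : ℕ}
    (hi : K ≤ i) :
    kochTerm ((kochD hd hβ hβ1 k m z ^ n) v) (i + n + m') -
        kochTerm ((kochD hd hβ hβ1 k m z ^ n) v) (i + n) =
      (∏ j ∈ Finset.range n, (d * kochTerm z (i + j) ^ (d - 1) : ℂ)) *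
        (kochTerm v (i + m') - kochTerm v i) := by
  induction n with
  | zero => simp
  | succ n ih =>
    rw [pow_succ', Module.End.mul_apply, show i + (n + 1) + m' = i + n + m' + 1 by ring,
      ← add_assoc i n 1, kochTerm_kochD, kochTerm_kochD, hK _ (by omega), Finset.prod_range_succ]
    linear_combination (d * kochTerm z (i + n) ^ (d - 1) : ℂ) * ih

lemma left_eigenvector_pow {V : Type*} [AddCommGroup V] [Module ℂ V] {A : Module.End ℂ V}
    {ω : Module.Dual ℂ V} {μ : ℂ} (hω : ∀ v, ω (A v) = μ * ω v) (n : ℕ) (v : V) :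
    ω ((A ^ n) v) = μ ^ n * ω v := by
  induction n with
  | zero => simp
  | succ n ih => rw [pow_succ', Module.End.mul_apply, hω, ih, pow_succ']; ring

/-- In the periodic case the weights of the shift vanish at the multiples of `m'`, so the derivative
is nilpotent modulo `M_{0,m'}`. -/
lemma kochD_pow_mem_of_periodic {m' : ℕ+} (hle : KochLE (0, m') (k, m)) {z : kochM β k m}
    (hz : (z : KochSeq) ∈ kochM β 0 m') (v : kochM β k m) :
    ((kochD hd hβ hβ1 k m z ^ (m' : ℕ)) v : KochSeq) ∈ kochM β 0 m' := by
  have hβ0 := beta_ne_zero hd hβ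
  have hm' := m'.pos
  have hzT := (mem_kochM_iff.1 hz).1
  have hK : ∀ i, 0 ≤ i → kochTerm z (i + m') = kochTerm z i := by
    intro i _
    rcases i with _ | i
    · rw [kochTerm_eq_zero_of_dvd hβ0 hz (by simp), kochTerm_zero]
    · exact hzT _ (by omega)
  refine mem_kochM_of_kochLE hβ1 hle (Subtype.mem _) fun i hi => ?_
  -- write `i = m' q + r` with `1 ≤ r ≤ m'`: the last `r` shifts start at the index `m' q`
  have hr0 : 0 < (i - 1) % m' + 1 := Nat.succ_pos _
  have hr : (i - 1) % m' + 1 ≤ m' := Nat.mod_lt _ hm'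
  have hi' : m' * ((i - 1) / m') + ((i - 1) % m' + 1) = i := by
    have := Nat.div_add_mod (i - 1) m'
    omega
  generalize (i - 1) % m' + 1 = r at hr0 hr hi'
  generalize (i - 1) / m' = q at hi'
  have hsplit : kochD hd hβ hβ1 k m z ^ (m' : ℕ) =
      kochD hd hβ hβ1 k m z ^ r * kochD hd hβ hβ1 k m z ^ ((m' : ℕ) - r) := by
    rw [← pow_add, Nat.add_sub_cancel' hr]
  rw [← sub_eq_zero, hsplit, Module.End.mul_apply, ← hi',
    kochTerm_kochD_pow_sub hd hβ hβ1 hK _ _ (Nat.zero_le _),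
    Finset.prod_eq_zero (Finset.mem_range.2 hr0), zero_mul]
  rw [add_zero, kochTerm_eq_zero_of_dvd hβ0 hz (dvd_mul_right _ _), zero_pow (by omega), mul_zero]

lemma kochAnn_ne_bot {k' : ℕ} {m' : ℕ+} (hβ0 : β ≠ 0) (hβ1 : β ≠ 1) (hle : KochLE (k', m') (k, m))
    (hne : (k, m) ≠ (k', m')) : kochAnn β k m k' m' ≠ ⊥ := by
  intro hbot
  have := finiteDimensional_kochM hβ0 hβ1 k m
  have htop : (kochM β k' m').submoduleOf (kochM β k m) = ⊤ := by
    rw [kochAnn, ← Submodule.dualAnnihilator_top] at hbot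
    exact Subspace.dualAnnihilator_inj.1 hbot
  have hsub : kochM β k m ≤ kochM β k' m' := fun x hx => by
    have : (⟨x, hx⟩ : kochM β k m) ∈ (kochM β k' m').submoduleOf (kochM β k m) :=
      htop ▸ Submodule.mem_top
    exact this
  exact hne (kochLE_isPartialOrder.antisymm _ _ (kochLE_of_kochM_le hβ0 hβ1 hsub) hle)

lemma spectrum_kochAnn_of_periodic {m' : ℕ+} (hle : KochLE (0, m') (k, m))
    (hne : (k, m) ≠ (0, m')) {z : kochM β k m} (hz : (z : KochSeq) ∈ kochM β 0 m')
    (hinv : ∀ ω ∈ kochAnn β k m 0 m',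
      (kochD hd hβ hβ1 k m z).dualMap ω ∈ kochAnn β k m 0 m') :
    spectrum ℂ ((kochD hd hβ hβ1 k m z).dualMap.restrict hinv :
      Module.End ℂ (kochAnn β k m 0 m')) = {0} := by
  have hβ0 := beta_ne_zero hd hβ
  have := finiteDimensional_kochM hβ0 hβ1 k m
  have hnt : Nontrivial (kochAnn β k m 0 m') :=
    Submodule.nontrivial_iff_ne_bot.2 (kochAnn_ne_bot hβ0 hβ1 hle hne)
  refine Set.Nonempty.subset_singleton_iff
    (spectrum.nonempty_of_isAlgClosed_of_finiteDimensional ℂ _) |>.1 fun μ hμ => ?_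
  obtain ⟨ω, hωW, hω0, hω⟩ := (mem_spectrum_dualMap_restrict_iff hinv).1 hμ
  obtain ⟨v, hv⟩ : ∃ v, ω v ≠ 0 := by
    by_contra! hcon
    exact hω0 (LinearMap.ext hcon)
  have h1 := left_eigenvector_pow hω m' v
  rw [mem_kochAnn_iff.1 hωW _ (kochD_pow_mem_of_periodic hd hβ hβ1 hle hz v)] at h1
  exact eq_zero_of_pow_eq_zero ((mul_eq_zero.1 h1.symm).resolve_right hv)

/-- The product of `n` consecutive terms of a sequence of period `n` does not depend on where it
starts. -/
lemma prod_window_eq {a : ℕ → ℂ} {K n : ℕ} (ha : ∀ i, K ≤ i → a i ≠ 0)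
    (hper : ∀ i, K ≤ i → a (i + n) = a i) {i : ℕ} (hi : K ≤ i) :
    ∏ j ∈ Finset.range n, a (i + j) = ∏ j ∈ Finset.range n, a (K + j) := by
  induction i, hi using Nat.le_induction with
  | base => rfl
  | succ i hi ih =>
    rw [← ih]
    refine mul_right_cancel₀ (ha i hi) ?_
    conv_rhs => rw [← hper i hi, ← Finset.prod_range_succ, Finset.prod_range_succ']
    simp only [add_zero, add_assoc, add_comm 1]

lemma prod_window_mul {a : ℕ → ℂ} {K n : ℕ} (ha : ∀ i, K ≤ i → a i ≠ 0)
    (hper : ∀ i, K ≤ i → a (i + n) = a i) (l : ℕ) {i : ℕ} (hi : K ≤ i) :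
    ∏ j ∈ Finset.range (n * l), a (i + j) = (∏ j ∈ Finset.range n, a (K + j)) ^ l := by
  induction l with
  | zero => simp
  | succ l ih =>
    rw [mul_add, mul_one, Finset.prod_range_add, ih, pow_succ]
    simp_rw [← add_assoc]
    rw [prod_window_eq ha hper (show K ≤ i + n * l by omega)]

/-- In the strictly preperiodic case, `T = λ^{-1} (D_zF)^{m'}` acts on the quotient
`M_{k,m} / M_{k,m'}` as a shift by `m'` of order `p = m / m'` without invariant vectors, so
`1 + T + ⋯ + T^{p-1} = 0` there. -/
lemma sum_kochD_pow_mem {p : ℕ} {m' : ℕ+} (hm : (m : ℕ) = m' * p) {z : kochM β k m} {lam : ℂ}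
    (hzT : KochHasType z k m') (hz0 : ∀ i, 0 < i → kochTerm z i ≠ 0)
    (hlam : lam = ∏ j ∈ Finset.range m', (d * kochTerm z (k + 1 + j) ^ (d - 1) : ℂ))
    (v : kochM β k m) :
    ((∑ j ∈ Finset.range p, lam ^ (p - 1 - j) • (kochD hd hβ hβ1 k m z ^ ((m' : ℕ) * j)) v :
      kochM β k m) : KochSeq) ∈ kochM β k m' := by
  have hd0 : (d : ℂ) ≠ 0 := Nat.cast_ne_zero.2 (by omega)
  have ha : ∀ i, k + 1 ≤ i → (d * kochTerm z i ^ (d - 1) : ℂ) ≠ 0 := fun i hi =>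
    mul_ne_zero hd0 (pow_ne_zero _ (hz0 i (by omega)))
  have hper : ∀ i, k + 1 ≤ i → (d * kochTerm z (i + m') ^ (d - 1) : ℂ) =
      d * kochTerm z i ^ (d - 1) := fun i hi => by rw [hzT i hi]
  refine mem_kochM_of_kochLE hβ1 ⟨⟨p, hm⟩, Or.inl rfl⟩ (Subtype.mem _) ?_
  refine KochHasType.of_eventually (N := k + 1 + m) m.pos (mem_kochM_iff.1 (Subtype.mem _)).1 ?_
  intro i hi
  obtain ⟨n, rfl⟩ : ∃ n, i = k + 1 + n + m := ⟨i - m - (k + 1), by omega⟩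
  have hterm : ∀ j ∈ Finset.range p,
      kochTerm ((kochD hd hβ hβ1 k m z ^ ((m' : ℕ) * j)) v) (k + 1 + n + m + m') -
        kochTerm ((kochD hd hβ hβ1 k m z ^ ((m' : ℕ) * j)) v) (k + 1 + n + m) =
      lam ^ j * (kochTerm v (k + 1 + n + m' * (p - 1 - j + 1) + m') -
        kochTerm v (k + 1 + n + m' * (p - 1 - j + 1))) := by
    intro j hj
    have hjp := Finset.mem_range.1 hj
    have hidx : k + 1 + n + (m : ℕ) = k + 1 + n + m' * (p - 1 - j + 1) + m' * j := by
      rw [hm, add_assoc (k + 1 + n), ← mul_add]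
      congr 2
      omega
    rw [hidx, kochTerm_kochD_pow_sub hd hβ hβ1 hzT _ _ (by omega),
      prod_window_mul (a := fun i => (d * kochTerm z i ^ (d - 1) : ℂ)) ha hper _ (by omega), hlam]
  rw [← sub_eq_zero]
  simp only [Submodule.coe_sum, Submodule.coe_smul, kochTerm_sum, kochTerm_smul]
  rw [← Finset.sum_sub_distrib]
  have hsum : ∀ j ∈ Finset.range p,
      lam ^ (p - 1 - j) * kochTerm ((kochD hd hβ hβ1 k m z ^ ((m' : ℕ) * j)) v)
          (k + 1 + n + m + m') -
        lam ^ (p - 1 - j) * kochTerm ((kochD hd hβ hβ1 k m z ^ ((m' : ℕ) * j)) v)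
          (k + 1 + n + m) =
      lam ^ (p - 1) * (kochTerm v (k + 1 + n + m' * (p - 1 - j + 1 + 1)) -
        kochTerm v (k + 1 + n + m' * (p - 1 - j + 1))) := by
    intro j hj
    have hjp := Finset.mem_range.1 hj
    rw [← mul_sub, hterm j hj, ← mul_assoc, ← pow_add, Nat.sub_add_cancel (by omega),
      mul_add (m' : ℕ) (p - 1 - j + 1) 1, mul_one, ← add_assoc (k + 1 + n) (m' * (p - 1 - j + 1))]
  rw [Finset.sum_congr rfl hsum, ← Finset.mul_sum,
    Finset.sum_range_reflect (fun l => kochTerm v (k + 1 + n + m' * (l + 1 + 1)) -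
      kochTerm v (k + 1 + n + m' * (l + 1))) p,
    Finset.sum_range_sub (fun l => kochTerm v (k + 1 + n + m' * (l + 1))) p]
  have hend : kochTerm v (k + 1 + n + m' * (p + 1)) = kochTerm v (k + 1 + n + m' * (0 + 1)) := by
    rw [← (mem_kochM_iff.1 v.2).1 (k + 1 + n + m' * (0 + 1)) (by omega), hm]
    congr 1
    ring
  rw [hend, sub_self, mul_zero]

/-- A sequence that is multiplied by a nontrivial `p`-th root of unity along each step of length `n`
has zero sum over `n p` terms. -/
lemma sum_range_mul_eq_zero {f : ℕ → ℂ} {n p : ℕ} {ξ : ℂ} (hf : ∀ i, f (i + n) = ξ * f i)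
    (hξ : ξ ^ p = 1) (hξ1 : ξ ≠ 1) : ∑ i ∈ Finset.range (n * p), f i = 0 := by
  have hpow : ∀ l i, f (n * l + i) = ξ ^ l * f i := by
    intro l i
    induction l with
    | zero => simp
    | succ l ih => rw [show n * (l + 1) + i = n * l + i + n by ring, hf, ih, pow_succ']; ring
  have hsum : ∀ l, ∑ i ∈ Finset.range (n * l), f i =
      (∑ j ∈ Finset.range l, ξ ^ j) * ∑ i ∈ Finset.range n, f i := by
    intro l
    induction l with
    | zero => simp
    | succ l ih =>
      rw [mul_add, mul_one, Finset.sum_range_add, ih, Finset.sum_range_succ, add_mul]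
      simp_rw [hpow, Finset.mul_sum]
  rw [hsum, geom_sum_eq hξ1, hξ, sub_self, zero_div, zero_mul]

/-- The left eigenvector for `μ` is `∑ c_n v_{k+1+n}` over one period, where
`c_n = μ^n / (a_{k+1} ⋯ a_{k+n})` and `a_i = P'(z_i)`. -/
lemma exists_left_eigenvector_of_pow_eq {p : ℕ} {m' : ℕ+} (hm : (m : ℕ) = m' * p)
    {z : kochM β k m} {lam μ : ℂ} (hzT : KochHasType z k m')
    (hz0 : ∀ i, 0 < i → kochTerm z i ≠ 0)
    (hlam : lam = ∏ j ∈ Finset.range m', (d * kochTerm z (k + 1 + j) ^ (d - 1) : ℂ))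
    (hμ : μ ^ (m : ℕ) = lam ^ p) (hμ' : μ ^ (m' : ℕ) ≠ lam) :
    ∃ ω ∈ kochAnn β k m k m', ω ≠ 0 ∧ ∀ v, ω (kochD hd hβ hβ1 k m z v) = μ * ω v := by
  have hd0 : (d : ℂ) ≠ 0 := Nat.cast_ne_zero.2 (by omega)
  set a : ℕ → ℂ := fun i => d * kochTerm z i ^ (d - 1) with ha_def
  have ha : ∀ i, k + 1 ≤ i → a i ≠ 0 := fun i hi =>
    mul_ne_zero hd0 (pow_ne_zero _ (hz0 i (by omega)))
  have hper : ∀ i, k + 1 ≤ i → a (i + m') = a i := fun i hi => by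
    simp only [ha_def]
    rw [hzT i hi]
  have hprod : ∀ n, ∏ j ∈ Finset.range n, a (k + 1 + j) ≠ 0 := fun n =>
    Finset.prod_ne_zero_iff.2 fun j _ => ha _ (by omega)
  have hlam0 : lam ≠ 0 := hlam ▸ hprod m'
  set c : ℕ → ℂ := fun n => μ ^ n / ∏ j ∈ Finset.range n, a (k + 1 + j) with hc_def
  have hc0 : c 0 = 1 := by simp [hc_def]
  have hcm : c m = 1 := by
    simp only [hc_def]
    rw [hμ, hm, prod_window_mul ha hper p le_rfl, ← hlam, div_self (pow_ne_zero _ hlam0)]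
  have hcs : ∀ n, c (n + 1) * a (k + 1 + n) = μ * c n := by
    intro n
    have h1 := hprod n
    have h2 := ha (k + 1 + n) (by omega)
    simp only [hc_def]
    rw [Finset.prod_range_succ, pow_succ]
    field_simp
  have hcm' : ∀ n, c (n + m') = μ ^ (m' : ℕ) / lam * c n := by
    intro n
    have h1 := hprod n
    simp only [hc_def]
    have h2 : ∏ j ∈ Finset.range (n + m'), a (k + 1 + j) =
        (∏ j ∈ Finset.range n, a (k + 1 + j)) * lam := by
      rw [Finset.prod_range_add]
      simp_rw [← add_assoc]
      rw [prod_window_eq ha hper (show k + 1 ≤ k + 1 + n by omega), ← hlam]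
    rw [h2, pow_add]
    field_simp
  -- `c` annihilates the sequences of period `m'`, in particular the constants
  have hann : ∀ x : ℕ → ℂ, (∀ n, x (n + m') = x n) → ∑ n ∈ Finset.range m, c n * x n = 0 := by
    intro x hx
    rw [hm]
    refine sum_range_mul_eq_zero (ξ := μ ^ (m' : ℕ) / lam) (fun i => ?_) ?_ ?_
    · rw [hx, hcm', mul_assoc]
    · rw [div_pow, ← pow_mul, ← hm, hμ, div_self (pow_ne_zero _ hlam0)]
    · rwa [Ne, div_eq_one_iff_eq hlam0]
  have hcsum : ∑ n ∈ Finset.range m, c n = 0 := by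
    simpa using hann (fun _ => 1) fun _ => rfl
  let ω : Module.Dual ℂ (kochM β k m) :=
    { toFun := fun v => ∑ n ∈ Finset.range m, c n * kochTerm v (k + 1 + n)
      map_add' := fun v w => by
        simp only [Submodule.coe_add, kochTerm_add, mul_add, Finset.sum_add_distrib]
      map_smul' := fun t v => by
        simp only [Submodule.coe_smul, kochTerm_smul, Finset.mul_sum, smul_eq_mul,
          RingHom.id_apply]
        exact Finset.sum_congr rfl fun _ _ => by ring }
  have hω : ∀ v, ω v = ∑ n ∈ Finset.range m, c n * kochTerm v (k + 1 + n) := fun _ => rfl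
  have hproj : ∀ x : KochSeq, ∑ n ∈ Finset.range m, c n * kochTerm (kochProj β k m x) (k + 1 + n) =
      ∑ n ∈ Finset.range m, c n * kochTerm x (k + 1 + n) := by
    intro x
    have h1 : ∀ n ∈ Finset.range m, c n * kochTerm (kochProj β k m x) (k + 1 + n) =
        c n * kochTerm x (k + 1 + n) - c n * kochShift β k m x := fun n _ => by
      rw [kochTerm_proj _ _ _ _ (by omega), mul_sub]
    rw [Finset.sum_congr rfl h1, Finset.sum_sub_distrib, ← Finset.sum_mul, hcsum, zero_mul,
      sub_zero]
  refine ⟨ω, mem_kochAnn_iff.2 fun v hv => ?_, fun h0 => ?_, fun v => ?_⟩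
  · rw [hω]
    refine hann (fun n => kochTerm v (k + 1 + n)) fun n => ?_
    rw [← add_assoc, (mem_kochM_iff.1 hv).1 _ (by omega)]
  · have h1 := LinearMap.congr_fun h0 (kochPM hβ1 k m (kochSingle k m (k + 1)))
    rw [hω, coe_kochPM, hproj, Finset.sum_eq_single_of_mem 0 (Finset.mem_range.2 m.pos)] at h1
    · rw [hc0, add_zero, kochTerm_kochSingle _ _ _ (Nat.succ_pos k),
        kochIndex_of_le (Nat.add_le_add_left m.pos k), if_pos rfl] at h1
      simp at h1
    · intro n hn hn0
      have := Finset.mem_range.1 hn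
      rw [kochTerm_kochSingle _ _ _ (by omega), kochIndex_of_le (by omega), if_neg (by omega),
        mul_zero]
  · rw [hω, coe_kochD_apply, hproj, hω]
    have hb : kochTerm (kochDQ d z v) (k + 1 + m) = kochTerm (kochDQ d z v) (k + 1) :=
      kochHasType_kochDQ hd hβ z.2 v.2 _ le_rfl
    have hshift := Finset.sum_range_succ' (fun n => c n * kochTerm (kochDQ d z v) (k + 1 + n)) m
    rw [Finset.sum_range_succ, hcm, hc0, add_zero, hb] at hshift
    rw [add_right_cancel hshift, Finset.mul_sum]
    refine Finset.sum_congr rfl fun n _ => ?_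
    have h1 := hcs n
    simp only [ha_def] at h1
    rw [← add_assoc, kochTerm_kochDQ]
    linear_combination kochTerm v (k + 1 + n) * h1

lemma spectrum_kochAnn_of_preperiodic {m' : ℕ+} (hm : (m' : ℕ) ∣ m) {z : kochM β k m}
    {lam : ℂ} (hzT : KochHasType z k m') (hz0 : ∀ i, 0 < i → kochTerm z i ≠ 0)
    (hlam : lam = ∏ j ∈ Finset.range m', (d * kochTerm z (k + 1 + j) ^ (d - 1) : ℂ))
    (hinv : ∀ ω ∈ kochAnn β k m k m',
      (kochD hd hβ hβ1 k m z).dualMap ω ∈ kochAnn β k m k m') :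
    spectrum ℂ ((kochD hd hβ hβ1 k m z).dualMap.restrict hinv :
      Module.End ℂ (kochAnn β k m k m')) =
      {μ : ℂ | μ ^ (m : ℕ) = lam ^ ((m : ℕ) / (m' : ℕ)) ∧ μ ^ (m' : ℕ) ≠ lam} := by
  have := finiteDimensional_kochM (beta_ne_zero hd hβ) hβ1 k m
  have hd0 : (d : ℂ) ≠ 0 := Nat.cast_ne_zero.2 (by omega)
  have hp := (Nat.mul_div_cancel' hm).symm
  have hp0 : (m : ℕ) / m' ≠ 0 := (Nat.div_pos (Nat.le_of_dvd m.pos hm) m'.pos).ne'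
  generalize (m : ℕ) / m' = p at hp hp0
  have hlam0 : lam ≠ 0 := hlam ▸ Finset.prod_ne_zero_iff.2 fun j _ =>
    mul_ne_zero hd0 (pow_ne_zero _ (hz0 _ (by omega)))
  ext μ
  rw [mem_spectrum_dualMap_restrict_iff hinv, Set.mem_ofPred_eq]
  constructor
  · rintro ⟨ω, hωW, hω0, hω⟩
    obtain ⟨v, hv⟩ : ∃ v, ω v ≠ 0 := by
      by_contra! hcon
      exact hω0 (LinearMap.ext hcon)
    have h1 := mem_kochAnn_iff.1 hωW _ (sum_kochD_pow_mem hd hβ hβ1 hp hzT hz0 hlam v)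
    simp only [map_sum, map_smul, left_eigenvector_pow hω, smul_eq_mul, ← mul_assoc] at h1
    rw [← Finset.sum_mul] at h1
    have h2 : ∑ j ∈ Finset.range p, (μ ^ (m' : ℕ)) ^ j * lam ^ (p - 1 - j) = 0 := by
      rw [← (mul_eq_zero.1 h1).resolve_right hv]
      exact Finset.sum_congr rfl fun j _ => by rw [pow_mul, mul_comm]
    constructor
    · have h3 := (Commute.all (μ ^ (m' : ℕ)) lam).geom_sum₂_mul p
      rw [h2, zero_mul, ← pow_mul, ← hp] at h3
      exact (sub_eq_zero.1 h3.symm)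
    · intro h3
      have h4 : ∀ j ∈ Finset.range p, (μ ^ (m' : ℕ)) ^ j * lam ^ (p - 1 - j) = lam ^ (p - 1) := by
        intro j hj
        have := Finset.mem_range.1 hj
        rw [h3, ← pow_add]
        congr 1
        omega
      rw [Finset.sum_congr rfl h4, Finset.sum_const, Finset.card_range, nsmul_eq_mul] at h2
      exact mul_ne_zero (Nat.cast_ne_zero.2 hp0) (pow_ne_zero _ hlam0) h2
  · rintro ⟨h1, h2⟩
    exact exists_left_eigenvector_of_pow_eq hd hβ hβ1 hp hzT hz0 hlam h1 h2

end Transverse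

end

theorem mainTheorem3 {d : ℕ} (hd : 2 ≤ d) {β : ℂ} (hβ : β ^ d = 1) (hβ1 : β ≠ 1) :
    -- the partial order
    (IsPartialOrder (ℕ × ℕ+) KochLE ∧
      ∀ (k : ℕ) (m : ℕ+) (k' : ℕ) (m' : ℕ+),
        KochLE (k', m') (k, m) ↔
          kochM β k' m' ≤ kochM β k m ∧
          Set.MapsTo (kochMap d β k m) (kochM β k' m') (kochM β k' m') ∧
          Set.EqOn (kochMap d β k m) (kochMap d β k' m') (kochM β k' m')) ∧
    ∀ (k : ℕ) (m : ℕ+),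
      -- `F_{k,m}` is holomorphic and holomorphically conjugate to `G_{k,m}`
      Differentiable ℂ (kochF hd hβ hβ1 k m) ∧
      HolomorphicallyConjugate (kochF hd hβ hβ1 k m) (kochG d β k m) ∧
      -- fixed points
      ∀ z : kochM β k m, z ≠ 0 → kochF hd hβ hβ1 k m z = z →
        ∀ (k' : ℕ) (m' : ℕ+), KochHasExactType z k' m' →
          let P : Polynomial ℂ := Polynomial.X ^ d + Polynomial.C (z.1 1)
          let lam : ℂ := cycleMultiplier P ((fun t => P.eval t)^[k'] (z.1 1)) m'
          -- the associated polynomial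
          PostCriticallyFinite P ∧
          (∀ j : ℕ+, z.1 j = (fun t => P.eval t)^[(j : ℕ)] 0) ∧
          IsPreperiodicPoint (fun t => P.eval t) (z.1 1) k' m' ∧
          KochLE (k', m') (k, m) ∧
          -- the spectrum along `M_{k',m'}`
          (∃ hz : z.1 ∈ kochM β k' m',
            spectrum ℂ (kochD hd hβ hβ1 k' m' ⟨z.1, hz⟩) ⊆ (Metric.closedBall (0 : ℂ) 1)ᶜ) ∧
          -- the spectrum of the transpose on the annihilator of `M_{k',m'}`
          ((k, m) ≠ (k', m') →
            ∃ hinv : ∀ ω ∈ kochAnn β k m k' m',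
                (kochD hd hβ hβ1 k m z).dualMap ω ∈ kochAnn β k m k' m',
              spectrum ℂ (((kochD hd hβ hβ1 k m z).dualMap.restrict hinv :
                  Module.End ℂ (kochAnn β k m k' m'))) =
                if k' = 0 then {0}
                else {μ : ℂ | μ ^ (m : ℕ) = lam ^ ((m : ℕ) / (m' : ℕ)) ∧ μ ^ (m' : ℕ) ≠ lam}) := by
  refine ⟨⟨kochLE_isPartialOrder, kochLE_iff hd hβ hβ1⟩, fun k m =>
    ⟨differentiable_kochF hd hβ hβ1 k m, kochF_conjugate_kochG hd hβ hβ1 k m, ?_⟩⟩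
  intro z _ hfix k' m' hT P lam
  have hz := kochTerm_succ_of_fixed hd hβ hβ1 hfix
  have hz1 : kochTerm z 1 = z.1 1 := kochTerm_coe z.1 1
  have hle : KochLE (k', m') (k, m) := kochLE_of_exactType hβ1 hz z.2 hT
  have hzM : z.1 ∈ kochM β k' m' := mem_kochM_of_kochLE hβ1 hle z.2 hT.2.1
  have hlam : lam = ∏ j ∈ Finset.range m', (d * kochTerm z (k' + 1 + j) ^ (d - 1) : ℂ) := by
    rw [← cycleMultiplier_eq_prod hz, add_comm k', ← iterate_eval_eq_kochTerm hz, hz1]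
  refine ⟨postCriticallyFinite_of_type hd hz m'.pos hT.2.1, fun j => ?_, ?_, hle,
    ⟨hzM, spectrum_kochD_subset hd hβ hβ1 ⟨z.1, hzM⟩ hz hT⟩,
    fun hne => ⟨kochD_dualMap_mem_kochAnn hd hβ hβ1 hle hzM, ?_⟩⟩
  · have := iterate_eval_eq_kochTerm hz j 0
    rw [kochTerm_zero, zero_add, kochTerm_coe] at this
    exact this.symm
  · rw [← hz1]
    exact isPreperiodicPoint_of_exactType (hz1 ▸ hz) hT
  · split_ifs with hk
    · subst hk
      exact spectrum_kochAnn_of_periodic hd hβ hβ1 hle hne hzM _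
    · obtain rfl : k' = k := hle.2.resolve_right fun h => hk h.1
      exact spectrum_kochAnn_of_preperiodic hd hβ hβ1 hle.1 hT.2.1
        (fun i hi h0 => hk (dvd_of_kochTerm_eq_zero hz hT hi h0).1) hlam _
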